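/- Let $q$ be a prime power, $\mathbb F_{q^2}$ the quadratic extension of $\mathbb F_q$, $r=(q^2-q)/2$, and let $\alpha_1,\dots,\alpha_q\in\mathbb F_q$ and $\beta_1,\dots,\beta_r\in\mathbb F_{q^2}$ be such that $\alpha_1,\dots,\alpha_q,\beta_1,\beta_1^q,\dots,\beta_r,\beta_r^q$ lists every element of $\mathbb F_{q^2}$ exactly once. Put $e_{i,j}(x)=x^{iq+j}+x^{jq+i}$ for $i\neq j$ and $e_{i,i}(x)=x^{iq+i}$. For $2\le m\le q-1$ and $0\le \ell\le m-1$ let $V_{m,\ell}$ be the $\mathbb F_q$-span of the $e_{i,j}$ with $0\le i\le j\le m-2$ and the $e_{i,m-1}$ with $0\le i\le \ell$, and let $W_5$ be the $\mathbb F_q$-span of $1,\ x^q+x,\ (x^q+x)^2,\ x^{q+1},\ x^{2(q+1)}$. For $0\le t\le q$ let $C_q(t,m,\ell)$ and $\mathcal E$ be the $q$-ary linear codes of length $n=t+r$ consisting of the words $(f(\alpha_1),\dots,f(\alpha_t),f(\beta_1),\dots,f(\beta_r))$ with $f\in V_{m,\ell}$, respectively $f\in W_5$. Put $$\delta=n-\tfrac12\bigl(q(m-1)+\ell+g\bigr),\qquad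 g=\begin{cases}\min\{\max\{2(m-2),m+\ell-1\},t\} & q \text{ odd},\\ \max\{\min\{m-2,t\},2t-q\} & q \text{ even},\ \ell\le m-2,\\ \max\{\min\{m-1,t\},2t-q\} & q\text{ even},\ \ell=m-1.\end{cases}$$ An $[[n,k,\{d_z,d_x\}]]_q$ asymmetric quantum code is a stabilizer code in $(\mathbb C^q)^{\otimes n}$ of dimension $q^k$ that detects every combination of up to $d_x-1$ bit-flips and up to $d_z-1$ phase-flips simultaneously. The CSS construction associates with linear codes $C_1,C_2\subseteq\mathbb F_q^n$ such that $C_1^\perp\subseteq C_2$ (Euclidean dual) the space of vectors fixed by all bit-flip operators $X(w)$ with $w\in C_2^\perp$ and all phase-flip operators $Z(b)$ with $b\in C_1^\perp$; its distances are $d_z=\mathrm{wt}(C_2\setminus C_1^\perp)$ and $d_x=\mathrm{wt}(C_1\setminus C_2^\perp)$, where $\mathrm{wt}(\cdot)$ is the minimum Hamming weight. **Theorem.** (i) Let $q\ge5$, $0\le t\le q$, $4\le m\le q-1$ and $0\le\ell\le m-1$. Then $\mathcal E\subsetneq C_q(t,m,\ell)$, and the CSS construction applied to $C_1=\mathcal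 E^\perp$ and $C_2=C_q(t,m,\ell)$ gives an asymmetric quantum code with parameters $$\Bigl[\Bigl[\,t+\tfrac{q^2-q}2,\ \tfrac{m(m-1)}2+\ell-4,\ \{d_z\ge\delta,\ d_x=4\}\Bigr]\Bigr]_q .$$ (ii) Let $q=4$, $1\le t\le4$ and $(m,\ell)=(3,2)$. Then $\mathcal E\subsetneq C_4(t,3,2)$, and the CSS construction applied to $C_1=\mathcal E^\perp$ and $C_2=C_4(t,3,2)$ gives an asymmetric quantum code with parameters $[[t+6,1,\{d_z\ge\delta,\ d_x=4\}]]_4$. In both cases $d_x=4$ is exact: $\mathrm{wt}(C_1\setminus C_2^\perp)=4$, and the quantum code does not detect all combinations of up to $4$ bit-flips. -/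

import Mathlib

open Polynomial

noncomputable section

namespace AsymQuantum

/-! ### Linear codes -/

section Classical

variable {F : Type*} [Field F] {ι : Type*} [Fintype ι]

/-- The Euclidean dual `C^⊥` of a linear code `C ⊆ F^ι`. -/
def dualCode (C : Submodule F (ι → F)) : Submodule F (ι → F) where
  carrier := {u | ∀ v ∈ C, u ⬝ᵥ v = 0}
  zero_mem' := fun v _ => zero_dotProduct v
  add_mem' := fun {a b} ha hb v hv => by
    rw [add_dotProduct, ha v hv, hb v hv, add_zero]
  smul_mem' := fun c a ha v hv => by
    rw [smul_dotProduct, ha v hv, smul_zero]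

/-- The set of Hamming weights of the words in `C ∖ D`; its least element is `wt(C ∖ D)`. -/
def diffWeights [DecidableEq F] (C D : Submodule F (ι → F)) : Set ℕ :=
  {w | ∃ u, u ∈ C ∧ u ∉ D ∧ hammingNorm u = w}

end Classical

/-! ### Quantum codes in `(ℂ^q)^{⊗ n}` -/

section Quantum

variable {F : Type*} [Field F] [Fintype F]

/-- The canonical additive character `x ↦ exp (2 π i Tr(x) / p)` of the finite field `F` of
characteristic `p`, where `Tr` is the absolute trace `F → ZMod p`. -/
def stdChar (F : Type*) [Field F] [Fintype F] : AddChar F ℂ :=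
  haveI : NeZero (ringChar F) := ⟨CharP.char_ne_zero_of_finite F (ringChar F)⟩
  letI : Algebra (ZMod (ringChar F)) F := ZMod.algebra F (ringChar F)
  (ZMod.stdAddChar (N := ringChar F)).compAddMonoidHom
    (Algebra.trace (ZMod (ringChar F)) F).toAddMonoidHom

/-- The Hilbert space `(ℂ^q)^{⊗ n}`, with orthonormal basis
`|v⟩ = |v₁⟩ ⊗ ⋯ ⊗ |vₙ⟩` indexed by `v ∈ F^n`, `F` being the field with `q` elements. A vector is
given by its coordinates `ψ v`. -/
abbrev QuditSpace (F : Type*) [Fintype F] (n : ℕ) : Type _ :=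
  EuclideanSpace ℂ (Fin n → F)

variable {n : ℕ}

/-- The bit-flip operator `X(a) : |v⟩ ↦ |v + a⟩`. -/
def opX (a : Fin n → F) : QuditSpace F n ≃ₗ[ℂ] QuditSpace F n where
  toFun ψ := WithLp.toLp 2 fun v => ψ (v - a)
  invFun ψ := WithLp.toLp 2 fun v => ψ (v + a)
  map_add' _ _ := rfl
  map_smul' _ _ := rfl
  left_inv ψ := by ext v; simp
  right_inv ψ := by ext v; simp

/-- The phase-flip operator `Z(b) : |v⟩ ↦ χ(b · v) |v⟩`. -/
def opZ (b : Fin n → F) : QuditSpace F n ≃ₗ[ℂ] QuditSpace F n where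
  toFun ψ := WithLp.toLp 2 fun v => stdChar F (b ⬝ᵥ v) * ψ v
  invFun ψ := WithLp.toLp 2 fun v => stdChar F (-(b ⬝ᵥ v)) * ψ v
  map_add' φ ψ := by ext v; simp [mul_add]
  map_smul' c ψ := by ext v; simp [mul_left_comm]
  left_inv ψ := by
    ext v
    simp [← mul_assoc, ← AddChar.map_add_eq_mul]
  right_inv ψ := by
    ext v
    simp [← mul_assoc, ← AddChar.map_add_eq_mul]

/-- The error group on `n` qudits, generated by all bit-flip and phase-flip operators. -/
def errorGroup (F : Type*) [Field F] [Fintype F] (n : ℕ) :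
    Subgroup (QuditSpace F n ≃ₗ[ℂ] QuditSpace F n) :=
  Subgroup.closure (Set.range opX ∪ Set.range opZ)

/-- `Q` is a stabilizer code: the space of vectors fixed by an abelian subgroup of the error
group. -/
def IsStabilizerCode (Q : Submodule ℂ (QuditSpace F n)) : Prop :=
  ∃ S : Subgroup (QuditSpace F n ≃ₗ[ℂ] QuditSpace F n),
    S ≤ errorGroup F n ∧ (∀ g ∈ S, ∀ h ∈ S, g * h = h * g) ∧
      ∀ ψ, ψ ∈ Q ↔ ∀ g ∈ S, g ψ = ψ

variable [DecidableEq F]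

/-- `Q` detects every combination of at most `dx - 1` bit-flips and at most `dz - 1` phase-flips:
with `P` the orthogonal projection onto `Q`, each such error `E = X(a) Z(b)` satisfies
`P E P = c P` for a scalar `c`. -/
def Detects (Q : Submodule ℂ (QuditSpace F n)) (dz dx : ℕ) : Prop :=
  ∀ a b : Fin n → F, hammingNorm a < dx → hammingNorm b < dz →
    ∃ c : ℂ, ∀ φ ∈ Q, ∀ ψ ∈ Q, inner ℂ φ (opX a (opZ b ψ)) = c * inner ℂ φ ψ

/-- `Q` is an (asymmetric, stabilizer) quantum code with parameters `[[n, k, {dz, dx}]]_q`,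
where `q = |F|`. -/
structure IsAQC (Q : Submodule ℂ (QuditSpace F n)) (k dz dx : ℕ) : Prop where
  stabilizer : IsStabilizerCode Q
  dim : Module.finrank ℂ Q = Fintype.card F ^ k
  dz_pos : 0 < dz
  dx_pos : 0 < dx
  detects : Detects Q dz dx

/-- The space of the CSS code of a pair of linear codes `C₁`, `C₂` of length `n`: the vectors
fixed by all `X(w)` with `w ∈ C₂^⊥` and all `Z(b)` with `b ∈ C₁^⊥`. -/
def cssSpace (C₁ C₂ : Submodule F (Fin n → F)) : Submodule ℂ (QuditSpace F n) where
  carrier := {ψ | (∀ w ∈ dualCode C₂, opX w ψ = ψ) ∧ ∀ b ∈ dualCode C₁, opZ b ψ = ψ}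
  zero_mem' := ⟨fun w _ => map_zero (opX w), fun b _ => map_zero (opZ b)⟩
  add_mem' := fun {φ ψ} hφ hψ =>
    ⟨fun w hw => by rw [map_add, hφ.1 w hw, hψ.1 w hw],
      fun b hb => by rw [map_add, hφ.2 b hb, hψ.2 b hb]⟩
  smul_mem' := fun c ψ hψ =>
    ⟨fun w hw => by rw [map_smul, hψ.1 w hw], fun b hb => by rw [map_smul, hψ.2 b hb]⟩

/-- `Q` is obtained from `C₁`, `C₂` by the standard CSS construction, with distances
`dz = wt(C₂ ∖ C₁^⊥)` and `dx = wt(C₁ ∖ C₂^⊥)`. -/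
structure IsCSS (Q : Submodule ℂ (QuditSpace F n)) (C₁ C₂ : Submodule F (Fin n → F))
    (dz dx : ℕ) : Prop where
  nested : dualCode C₁ ≤ C₂
  space : Q = cssSpace C₁ C₂
  dz_eq : IsLeast (diffWeights C₂ (dualCode C₁)) dz
  dx_eq : IsLeast (diffWeights C₁ (dualCode C₂)) dx

end Quantum

/-! ### Xing–Ling codes -/

section XL

variable {F K : Type*} [Field F] [Field K] [Algebra F K]

/-- `α₁, …, α_q, β₁, β₁^q, …, β_r, β_r^q` lists every element of `K` exactly once. -/
def IsListing {q r : ℕ} (α : Fin q → F) (β : Fin r → K) : Prop :=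
  Function.Bijective
    (Sum.elim (fun i => algebraMap F K (α i)) (Sum.elim β (fun j => β j ^ q)) :
      Fin q ⊕ (Fin r ⊕ Fin r) → K)

/-- The evaluation points `(α₁, …, α_t, β₁, …, β_r)`. -/
def evalPoints {q r t : ℕ} (α : Fin q → F) (β : Fin r → K) (ht : t ≤ q) : Fin (t + r) → K :=
  Fin.append (fun i : Fin t => algebraMap F K (α (Fin.castLE ht i))) β

/-- The polynomial `e_{i,j}`. -/
def ePoly (F : Type*) [Field F] (q i j : ℕ) : F[X] :=
  if i = j then X ^ (i * q + j) else X ^ (i * q + j) + X ^ (j * q + i)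

/-- The space `V_{m,ℓ}`, for `m ≥ 2`. -/
def xlSpace (F : Type*) [Field F] (q m l : ℕ) : Submodule F F[X] :=
  Submodule.span F
    ({f | ∃ i j, i ≤ j ∧ j ≤ m - 2 ∧ f = ePoly F q i j} ∪
      {f | ∃ i, i ≤ l ∧ f = ePoly F q i (m - 1)})

/-- The space `W₅`. -/
def wFive (F : Type*) [Field F] (q : ℕ) : Submodule F F[X] :=
  Submodule.span F
    {1, X ^ q + X, (X ^ q + X) ^ 2, X ^ (q + 1), X ^ (2 * (q + 1))}

/-- The evaluation code of a space `V` of polynomials over `F` at points `P i` of the extension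
field `K`: the words over `F` of the form `(f(P i))_i` with `f ∈ V`. (For `V = V_{m,ℓ}` and
`V = W₅` all these values do lie in `F`.) -/
def evalCode {ι : Type*} (V : Submodule F F[X]) (P : ι → K) : Submodule F (ι → F) where
  carrier := {c | ∃ f ∈ V, ∀ i, algebraMap F K (c i) = aeval (P i) f}
  zero_mem' := ⟨0, V.zero_mem, fun i => by simp⟩
  add_mem' := by
    rintro a b ⟨f, hf, hfa⟩ ⟨g, hg, hgb⟩
    exact ⟨f + g, V.add_mem hf hg, fun i => by simp [hfa, hgb]⟩
  smul_mem' := by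
    rintro c a ⟨f, hf, hfa⟩
    exact ⟨c • f, V.smul_mem c hf, fun i => by simp [hfa, Algebra.smul_def]⟩

/-- The integer `g` in the designed distance of the code `C_q(t,m,ℓ)`. -/
def gParam (q t m l : ℕ) : ℤ :=
  if Odd q then min (max (2 * ((m : ℤ) - 2)) ((m : ℤ) + l - 1)) t
  else if l + 2 ≤ m then max (min ((m : ℤ) - 2) t) (2 * (t : ℤ) - q)
  else max (min ((m : ℤ) - 1) t) (2 * (t : ℤ) - q)

/-- The designed distance `δ = n - (q (m - 1) + ℓ + g) / 2`, with `n = t + (q² - q) / 2`. -/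
def designDist (q t m l : ℕ) : ℚ :=
  ((t : ℚ) + ((q : ℚ) ^ 2 - q) / 2) -
    ((q : ℚ) * ((m : ℚ) - 1) + l + (gParam q t m l : ℚ)) / 2

end XL

end AsymQuantum

end

/-! The quantum side holds for any nested pair of codes. Invariance under the phase-flips puts the
support of a vector inside `C₁`; invariance under the bit-flips makes it constant on cosets of
`C₂^⊥`. So the code space is the space of functions on `C₁ / C₂^⊥` (`range_cosetExtend`), which
gives its dimension. An error outside `C₁` or `C₂` is detected by orthogonality or by a character
sum, and a light error inside both acts trivially (`detects_cssSpace`).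

For `d_z`, let `f` in `V_{m,ℓ}` have `A` zeros among the `α_i` and `B` among the `β_j`. Since `f`
has coefficients in `F`, the conjugates of the `β_j` are zeros as well, so `A + 2B ≤ deg f` and `2(A
+ B) ≤ deg f + A`. It remains to bound `A`. Put `T = X^q - X`. For odd `q` the symmetry of the
`e_{i,j}` gives a `d` of small degree with `2f ≡ 2d + T d' (mod T²)`; for even `q` it gives `f ≡ d²
(mod T)`. If `d ≠ 0`, the rational zeros of `f` are zeros of `d`. If `d = 0`, then `T²`,
respectively `T`, divides `f`; as `T` vanishes at no `β_j`, this lowers the bound on `B`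
(`two_mul_card_zeros_le`).

For `d_x`, trace `s` and norm `p` turn the evaluation points into distinct points of the plane `F²`,
and `W₅` into the span of `1, s, s², p, p²`. These functions separate a point from any two others,
so nonzero dual words have weight at least 4 (`IsTraceNorm.four_le_hammingNorm`). Equality needs
four points with a relation that `s p`, the value of `e_{1,2}`, violates. For `q ≥ 5` the vertices
of an axis-parallel rectangle serve, found by an explicit family (odd `q`) or by counting (even
`q`); for `q = 4` a rational point is combined with three others. -/

namespace AsymQuantum

/-! ### Euclidean duality of linear codes -/

section DualCode

variable {F : Type*} [Field F] {ι : Type*} [Fintype ι]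

theorem mem_dualCode {C : Submodule F (ι → F)} {u : ι → F} :
    u ∈ dualCode C ↔ ∀ v ∈ C, u ⬝ᵥ v = 0 := Iff.rfl

theorem dualCode_anti {C D : Submodule F (ι → F)} (h : C ≤ D) : dualCode D ≤ dualCode C :=
  fun _ hu v hv => hu v (h hv)

/-- The standard bilinear form on `F^ι`. -/
noncomputable def dotForm (F ι : Type*) [Field F] [Fintype ι] :
    LinearMap.BilinForm F (ι → F) :=
  dotProductBilin F F

theorem dotForm_apply (u v : ι → F) : dotForm F ι u v = u ⬝ᵥ v := rfl

theorem dotForm_isRefl : (dotForm F ι).IsRefl := fun u v h => by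
  rw [dotForm_apply] at h ⊢
  rw [dotProduct_comm, h]

theorem dotForm_nondegenerate : (dotForm F ι).Nondegenerate := by
  classical
  refine ⟨fun u h => ?_, fun u h => ?_⟩
  · ext i
    simpa [dotForm_apply] using h (Pi.single i 1)
  · ext i
    simpa [dotForm_apply] using h (Pi.single i 1)

theorem dualCode_eq_orthogonal (C : Submodule F (ι → F)) :
    dualCode C = (dotForm F ι).orthogonal C := by
  ext u
  rw [mem_dualCode, LinearMap.BilinForm.mem_orthogonal_iff]
  refine forall₂_congr fun v _ => ?_
  rw [dotProduct_comm]
  rfl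

theorem dualCode_dualCode (C : Submodule F (ι → F)) : dualCode (dualCode C) = C := by
  rw [dualCode_eq_orthogonal, dualCode_eq_orthogonal]
  exact LinearMap.BilinForm.orthogonal_orthogonal dotForm_nondegenerate dotForm_isRefl C

theorem finrank_dualCode (C : Submodule F (ι → F)) :
    Module.finrank F (dualCode C) = Fintype.card ι - Module.finrank F C := by
  rw [dualCode_eq_orthogonal, LinearMap.BilinForm.finrank_orthogonal dotForm_nondegenerate,
    Module.finrank_fintype_fun_eq_card]

theorem dotProduct_eq_zero_of_mem_dualCode {C : Submodule F (ι → F)} {u v : ι → F}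
    (hv : v ∈ C) (hu : u ∈ dualCode C) : v ⬝ᵥ u = 0 := by
  rw [dotProduct_comm]
  exact hu v hv

theorem exists_dotProduct_ne_zero {C : Submodule F (ι → F)} {u : ι → F} (hu : u ∉ C) :
    ∃ v ∈ dualCode C, u ⬝ᵥ v ≠ 0 := by
  by_contra! h
  rw [← dualCode_dualCode C] at hu
  exact hu h

theorem dualCode_le_of_nested {C₁ C₂ : Submodule F (ι → F)}
    (h : dualCode C₁ ≤ C₂) : dualCode C₂ ≤ C₁ := by
  rw [← dualCode_dualCode C₁]
  exact dualCode_anti h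

end DualCode

/-! ### The CSS construction: stabilizer, dimension, detected and undetected errors -/

section Quantum

variable {F : Type*} [Field F] [Fintype F]

/-- The trace form is nondegenerate and the standard character of `ZMod p` is injective. -/
theorem exists_stdChar_mul_ne_one {a : F} (ha : a ≠ 0) : ∃ c : F, stdChar F (c * a) ≠ 1 := by
  have : NeZero (ringChar F) := ⟨CharP.char_ne_zero_of_finite F (ringChar F)⟩
  let _ : Algebra (ZMod (ringChar F)) F := ZMod.algebra F (ringChar F)
  obtain ⟨c, hc⟩ := FiniteField.trace_to_zmod_nondegenerate F ha
  refine ⟨c, fun h => hc ?_⟩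
  have h' : ZMod.stdAddChar (N := ringChar F)
      (Algebra.trace (ZMod (ringChar F)) F (c * a)) = 1 := h
  rw [← (ZMod.stdAddChar (N := ringChar F)).map_zero_eq_one,
    ZMod.injective_stdAddChar.eq_iff] at h'
  rw [mul_comm]
  exact h'

variable {n : ℕ}

theorem opX_apply (a : Fin n → F) (ψ : QuditSpace F n) (v : Fin n → F) :
    opX a ψ v = ψ (v - a) := rfl

theorem opZ_apply (b : Fin n → F) (ψ : QuditSpace F n) (v : Fin n → F) :
    opZ b ψ v = stdChar F (b ⬝ᵥ v) * ψ v := rfl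

theorem opX_mul_opX_comm (a b : Fin n → F) : opX a * opX b = opX b * opX a := by
  refine LinearEquiv.ext fun ψ => PiLp.ext fun v => ?_
  simp only [LinearEquiv.mul_apply, opX_apply]
  rw [sub_right_comm]

theorem opZ_mul_opZ_comm (a b : Fin n → F) : opZ a * opZ b = opZ b * opZ a := by
  refine LinearEquiv.ext fun ψ => PiLp.ext fun v => ?_
  simp only [LinearEquiv.mul_apply, opZ_apply]
  ring

theorem opX_mul_opZ_comm {a b : Fin n → F} (h : b ⬝ᵥ a = 0) : opX a * opZ b = opZ b * opX a := by
  refine LinearEquiv.ext fun ψ => PiLp.ext fun v => ?_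
  simp only [LinearEquiv.mul_apply, opZ_apply, opX_apply, dotProduct_sub, h, sub_zero]

/-- At `v ∉ C` some `b` in the dual has `b · v ≠ 0`, and a multiple of `b` has a nontrivial
character value there, which forces `ψ v = 0`. -/
theorem forall_opZ_eq_iff (C : Submodule F (Fin n → F)) (ψ : QuditSpace F n) :
    (∀ b ∈ dualCode C, opZ b ψ = ψ) ↔ ∀ v, v ∉ C → ψ v = 0 := by
  constructor
  · intro h v hv
    obtain ⟨b, hb, hbv⟩ := exists_dotProduct_ne_zero hv
    rw [dotProduct_comm] at hbv
    obtain ⟨c, hc⟩ := exists_stdChar_mul_ne_one hbv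
    have h1 := congrArg (fun φ : QuditSpace F n => φ v) (h _ ((dualCode C).smul_mem c hb))
    simp only [opZ_apply, smul_dotProduct, smul_eq_mul] at h1
    by_contra h0
    exact hc (mul_right_cancel₀ h0 (h1.trans (one_mul _).symm))
  · intro h b hb
    refine PiLp.ext fun v => ?_
    rw [opZ_apply]
    by_cases hv : v ∈ C
    · rw [hb v hv, AddChar.map_zero_eq_one, one_mul]
    · rw [h v hv, mul_zero]

variable {C₁ C₂ : Submodule F (Fin n → F)}

theorem mem_cssSpace_iff {ψ : QuditSpace F n} :
    ψ ∈ cssSpace C₁ C₂ ↔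
      (∀ w ∈ dualCode C₂, ∀ v, ψ (v - w) = ψ v) ∧ ∀ v, v ∉ C₁ → ψ v = 0 := by
  rw [← forall_opZ_eq_iff]
  refine and_congr_left fun _ => forall₂_congr fun w _ => ?_
  exact ⟨fun h v => congrArg (fun φ : QuditSpace F n => φ v) h, fun h => PiLp.ext h⟩

/-- Nestedness makes the words of the two dual codes mutually orthogonal, so the generating
bit-flips commute with the generating phase-flips. -/
theorem isStabilizerCode_cssSpace (h : dualCode C₁ ≤ C₂) :
    IsStabilizerCode (cssSpace C₁ C₂) := by
  set k : Set (QuditSpace F n ≃ₗ[ℂ] QuditSpace F n) :=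
    opX '' (dualCode C₂ : Set (Fin n → F)) ∪ opZ '' (dualCode C₁ : Set (Fin n → F)) with hk
  refine ⟨Subgroup.closure k, Subgroup.closure_mono (Set.union_subset_union
    (Set.image_subset_range _ _) (Set.image_subset_range _ _)), ?_, fun ψ => ⟨?_, ?_⟩⟩
  · have hcomm : ∀ x ∈ k, ∀ y ∈ k, x * y = y * x := by
      rintro _ (⟨a, ha, rfl⟩ | ⟨a, ha, rfl⟩) _ (⟨b, hb, rfl⟩ | ⟨b, hb, rfl⟩)
      · exact opX_mul_opX_comm a b
      · exact opX_mul_opZ_comm (dotProduct_eq_zero_of_mem_dualCode (h hb) ha)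
      · exact (opX_mul_opZ_comm (dotProduct_eq_zero_of_mem_dualCode (h ha) hb)).symm
      · exact opZ_mul_opZ_comm a b
    have := Subgroup.isMulCommutative_closure hcomm
    exact fun g hg g' hg' => setLike_mul_comm hg hg'
  · rintro ⟨hX, hZ⟩ g hg
    induction hg using Subgroup.closure_induction with
    | mem x hx =>
      rcases hx with ⟨a, ha, rfl⟩ | ⟨b, hb, rfl⟩
      · exact hX a ha
      · exact hZ b hb
    | one => rfl
    | mul x y _ _ hx hy => rw [LinearEquiv.mul_apply, hy, hx]
    | inv x _ hx =>
      exact (LinearEquiv.symm_apply_eq x).2 hx.symm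
  · exact fun hψ => ⟨fun w hw => hψ _ (Subgroup.subset_closure (Or.inl ⟨w, hw, rfl⟩)),
      fun b hb => hψ _ (Subgroup.subset_closure (Or.inr ⟨b, hb, rfl⟩))⟩

open Classical in
/-- The function on `C₁` modulo `C₂^⊥`, extended by zero to the whole space. -/
noncomputable def cosetExtend (C₁ C₂ : Submodule F (Fin n → F)) :
    ((C₁ ⧸ (dualCode C₂).comap C₁.subtype) → ℂ) →ₗ[ℂ] QuditSpace F n where
  toFun g := WithLp.toLp 2 fun v =>
    if hv : v ∈ C₁ then g (Submodule.Quotient.mk ⟨v, hv⟩) else 0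
  map_add' g h := by ext v; by_cases hv : v ∈ C₁ <;> simp [hv]
  map_smul' c g := by ext v; by_cases hv : v ∈ C₁ <;> simp [hv]

theorem cosetExtend_apply_mem (g : (C₁ ⧸ (dualCode C₂).comap C₁.subtype) → ℂ) {v : Fin n → F}
    (hv : v ∈ C₁) : cosetExtend C₁ C₂ g v = g (Submodule.Quotient.mk ⟨v, hv⟩) :=
  dif_pos hv

theorem cosetExtend_apply_notMem (g : (C₁ ⧸ (dualCode C₂).comap C₁.subtype) → ℂ)
    {v : Fin n → F} (hv : v ∉ C₁) : cosetExtend C₁ C₂ g v = 0 :=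
  dif_neg hv

theorem cosetExtend_injective : Function.Injective (cosetExtend C₁ C₂) := by
  intro g h hgh
  funext x
  obtain ⟨⟨v, hv⟩, rfl⟩ := Submodule.Quotient.mk_surjective _ x
  have := congrArg (fun φ : QuditSpace F n => φ v) hgh
  simpa only [cosetExtend_apply_mem _ hv] using this

theorem range_cosetExtend (h : dualCode C₁ ≤ C₂) :
    LinearMap.range (cosetExtend C₁ C₂) = cssSpace C₁ C₂ := by
  have h' := dualCode_le_of_nested h
  ext ψ
  rw [mem_cssSpace_iff]
  constructor
  · rintro ⟨g, rfl⟩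
    refine ⟨fun w hw v => ?_, fun v hv => cosetExtend_apply_notMem g hv⟩
    by_cases hv : v ∈ C₁
    · have hvw := C₁.sub_mem hv (h' hw)
      rw [cosetExtend_apply_mem g hv, cosetExtend_apply_mem g hvw]
      congr 1
      rw [Submodule.Quotient.eq]
      simpa using hw
    · have hvw : v - w ∉ C₁ := fun hc => hv (by simpa using C₁.add_mem hc (h' hw))
      rw [cosetExtend_apply_notMem g hv, cosetExtend_apply_notMem g hvw]
  · rintro ⟨h1, h2⟩
    -- Any coset representative serves, because `ψ` is constant on cosets.
    refine ⟨fun x => ψ (Quotient.out x : C₁), PiLp.ext fun v => ?_⟩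
    by_cases hv : v ∈ C₁
    · rw [cosetExtend_apply_mem _ hv]
      set x : C₁ ⧸ (dualCode C₂).comap C₁.subtype := Submodule.Quotient.mk ⟨v, hv⟩ with hx
      have hout : (Submodule.Quotient.mk (Quotient.out x) :
          C₁ ⧸ (dualCode C₂).comap C₁.subtype) = Submodule.Quotient.mk ⟨v, hv⟩ :=
        (Quotient.out_eq x).trans hx
      rw [Submodule.Quotient.eq] at hout
      have h3 := h1 _ hout (Quotient.out x : C₁)
      simpa using h3.symm
    · rw [cosetExtend_apply_notMem _ hv, h2 v hv]

theorem finrank_cssSpace (h : dualCode C₁ ≤ C₂) :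
    Module.finrank ℂ (cssSpace C₁ C₂) =
      Fintype.card F ^ (Module.finrank F C₂ - Module.finrank F (dualCode C₁)) := by
  have h' := dualCode_le_of_nested h
  have : Finite (C₁ ⧸ (dualCode C₂).comap C₁.subtype) :=
    Finite.of_surjective _ (Submodule.Quotient.mk_surjective _)
  have : Fintype (C₁ ⧸ (dualCode C₂).comap C₁.subtype) := Fintype.ofFinite _
  rw [← range_cosetExtend h, LinearMap.finrank_range_of_inj cosetExtend_injective,
    Module.finrank_fintype_fun_eq_card, Module.card_eq_pow_finrank (K := F)]
  congr 1
  have h1 := Submodule.finrank_quotient_add_finrank ((dualCode C₂).comap C₁.subtype)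
  rw [(Submodule.comapSubtypeEquivOfLe h').finrank_eq, finrank_dualCode, Fintype.card_fin] at h1
  have h2 := finrank_dualCode C₁
  have h3 := Submodule.finrank_le C₁
  have h4 := Submodule.finrank_le C₂
  rw [Module.finrank_fintype_fun_eq_card] at h3 h4
  rw [Fintype.card_fin] at *
  omega

omit [Field F] in
theorem inner_eq_sum (φ ψ : QuditSpace F n) :
    inner ℂ φ ψ = ∑ v, ψ v * (starRingEnd ℂ) (φ v) := by
  simp [PiLp.inner_apply]

/-- The shift by `a` moves the support to a coset disjoint from `C₁`. -/
theorem inner_opX_opZ_eq_zero_of_notMem_left {a : Fin n → F} (ha : a ∉ C₁) (b : Fin n → F)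
    {φ ψ : QuditSpace F n} (hφ : φ ∈ cssSpace C₁ C₂) (hψ : ψ ∈ cssSpace C₁ C₂) :
    inner ℂ φ (opX a (opZ b ψ)) = 0 := by
  rw [mem_cssSpace_iff] at hφ hψ
  rw [inner_eq_sum]
  refine Finset.sum_eq_zero fun v _ => ?_
  by_cases hv : v ∈ C₁
  · have : v - a ∉ C₁ := fun hc => ha (by simpa using C₁.sub_mem hv hc)
    simp [opX_apply, opZ_apply, hψ.2 _ this]
  · simp [hφ.2 v hv]

theorem inner_opX_opZ_eq_zero_of_notMem_right (a : Fin n → F) {b : Fin n → F} (hb : b ∉ C₂)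
    {φ ψ : QuditSpace F n} (hφ : φ ∈ cssSpace C₁ C₂) (hψ : ψ ∈ cssSpace C₁ C₂) :
    inner ℂ φ (opX a (opZ b ψ)) = 0 := by
  rw [mem_cssSpace_iff] at hφ hψ
  obtain ⟨w, hw, hbw⟩ := exists_dotProduct_ne_zero hb
  obtain ⟨c, hc⟩ := exists_stdChar_mul_ne_one hbw
  rw [inner_eq_sum]
  set T := ∑ v, opX a (opZ b ψ) v * (starRingEnd ℂ) (φ v) with hT
  have hcw := (dualCode C₂).neg_mem ((dualCode C₂).smul_mem c hw)
  -- Translating the summation variable by `c • w` fixes both vectors and multiplies the sum by a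
  -- character value other than 1.
  have key : T = stdChar F (c * (b ⬝ᵥ w)) * T := by
    conv_lhs => rw [hT, ← Equiv.sum_comp (Equiv.addRight (c • w))]
    rw [hT, Finset.mul_sum]
    refine Finset.sum_congr rfl fun v _ => ?_
    have e1 : φ (v + c • w) = φ v := by simpa using hφ.1 _ hcw v
    have e2 : ψ (v + c • w - a) = ψ (v - a) := by
      have := hψ.1 _ hcw (v - a)
      rw [sub_neg_eq_add] at this
      rw [add_sub_right_comm, this]
    have e3 : b ⬝ᵥ (v + c • w - a) = c * (b ⬝ᵥ w) + b ⬝ᵥ (v - a) := by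
      simp only [dotProduct_sub, dotProduct_add, dotProduct_smul, smul_eq_mul]
      ring
    simp only [Equiv.coe_addRight, opX_apply, opZ_apply, e1, e2, e3, AddChar.map_add_eq_mul]
    ring
  by_contra h0
  exact hc (mul_right_cancel₀ h0 (key.symm.trans (one_mul T).symm))

variable [DecidableEq F]

theorem detects_cssSpace {dz dx : ℕ} (hz : ∀ w ∈ diffWeights C₂ (dualCode C₁), dz ≤ w)
    (hx : ∀ w ∈ diffWeights C₁ (dualCode C₂), dx ≤ w) :
    Detects (cssSpace C₁ C₂) dz dx := by
  intro a b ha hb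
  by_cases h1 : a ∈ C₁
  · by_cases h2 : b ∈ C₂
    · have h1' : a ∈ dualCode C₂ := by
        by_contra hn
        exact (hx _ ⟨a, h1, hn, rfl⟩).not_gt ha
      have h2' : b ∈ dualCode C₁ := by
        by_contra hn
        exact (hz _ ⟨b, h2, hn, rfl⟩).not_gt hb
      refine ⟨1, fun φ _ ψ hψ => ?_⟩
      rw [hψ.2 b h2', hψ.1 a h1', one_mul]
    · refine ⟨0, fun φ hφ ψ hψ => ?_⟩
      rw [inner_opX_opZ_eq_zero_of_notMem_right a h2 hφ hψ, zero_mul]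
  · refine ⟨0, fun φ hφ ψ hψ => ?_⟩
    rw [inner_opX_opZ_eq_zero_of_notMem_left h1 b hφ hψ, zero_mul]

theorem isAQC_cssSpace (h : dualCode C₁ ≤ C₂) {k dz dx : ℕ}
    (hk : Module.finrank F C₂ - Module.finrank F (dualCode C₁) = k)
    (hz : IsLeast (diffWeights C₂ (dualCode C₁)) dz)
    (hx : IsLeast (diffWeights C₁ (dualCode C₂)) dx) :
    IsAQC (cssSpace C₁ C₂) k dz dx where
  stabilizer := isStabilizerCode_cssSpace h
  dim := by rw [finrank_cssSpace h, hk]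
  dz_pos := by
    obtain ⟨u, -, hu, rfl⟩ := hz.1
    exact hammingNorm_pos_iff.2 fun h0 => hu (h0 ▸ zero_mem _)
  dx_pos := by
    obtain ⟨u, -, hu, rfl⟩ := hx.1
    exact hammingNorm_pos_iff.2 fun h0 => hu (h0 ▸ zero_mem _)
  detects := detects_cssSpace (fun _ hw => hz.2 hw) (fun _ hw => hx.2 hw)

/-- Let `ψ` be the indicator of `C₂^⊥` and `a` a word of `C₁ ∖ C₂^⊥` of weight `d`. Then `X(a) ψ`
lies in the code and is orthogonal to `ψ`. Pairing it with `ψ` forces the scalar `c` to vanish,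
while pairing it with itself gives a nonzero value. -/
theorem not_detects_cssSpace (h : dualCode C₁ ≤ C₂) {d : ℕ}
    (hd : d ∈ diffWeights C₁ (dualCode C₂)) : ¬ Detects (cssSpace C₁ C₂) 1 (d + 1) := by
  classical
  have h' := dualCode_le_of_nested h
  obtain ⟨a, ha1, ha2, rfl⟩ := hd
  intro hdet
  obtain ⟨c, hc⟩ := hdet a 0 (Nat.lt_succ_self _) (by simp)
  have hZ : ∀ ψ : QuditSpace F n, opZ 0 ψ = ψ := fun ψ => PiLp.ext fun v => by
    simp [opZ_apply]
  simp only [hZ] at hc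
  let ψ : QuditSpace F n := WithLp.toLp 2 fun v => if v ∈ dualCode C₂ then 1 else 0
  have hψv : ∀ v, ψ v = if v ∈ dualCode C₂ then 1 else 0 := fun _ => rfl
  have hψ : ψ ∈ cssSpace C₁ C₂ := by
    rw [mem_cssSpace_iff]
    refine ⟨fun w hw v => ?_, fun v hv => ?_⟩
    · rw [hψv, hψv, Submodule.sub_mem_iff_left _ hw]
    · rw [hψv, if_neg fun hc => hv (h' hc)]
  have hφ : opX a ψ ∈ cssSpace C₁ C₂ := by
    have hψ' := mem_cssSpace_iff.1 hψ
    rw [mem_cssSpace_iff]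
    refine ⟨fun w hw v => ?_, fun v hv => ?_⟩
    · rw [opX_apply, opX_apply, sub_right_comm, hψ'.1 w hw]
    · exact hψ'.2 _ fun hc => hv (by simpa using C₁.add_mem hc ha1)
  have hψ0 : ψ ≠ 0 := fun h0 => by
    have := congrArg (fun φ : QuditSpace F n => φ 0) h0
    simp [hψv] at this
  have hφ0 : opX a ψ ≠ 0 := fun h0 => hψ0 ((opX a).map_eq_zero_iff.1 h0)
  have hort : inner ℂ ψ (opX a ψ) = 0 := by
    rw [inner_eq_sum]
    refine Finset.sum_eq_zero fun v _ => ?_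
    rw [opX_apply, hψv, hψv]
    by_cases hv : v ∈ dualCode C₂
    · have : v - a ∉ dualCode C₂ := fun hc => ha2 (by simpa using Submodule.sub_mem _ hv hc)
      simp [this]
    · simp [hv]
  have h1 := hc ψ hψ ψ hψ
  rw [hort] at h1
  have hc0 : c = 0 := (mul_eq_zero.1 h1.symm).resolve_right (inner_self_ne_zero.2 hψ0)
  have h2 := hc _ hφ ψ hψ
  rw [hc0, zero_mul] at h2
  exact hφ0 (inner_self_eq_zero.1 h2)

end Quantum

end AsymQuantum

namespace AsymQuantum

/-! ### The `q`-power Frobenius on the quadratic extension -/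

section Frobenius

variable {F K : Type*} [Field F] [Fintype F] [Field K] [Algebra F K] {q : ℕ}

theorem aeval_pow_card (hq : Fintype.card F = q) (x : K) (f : F[X]) :
    aeval (x ^ q) f = aeval x f ^ q := by
  subst hq
  exact aeval_algHom_apply (FiniteField.frobeniusAlgHom F K) x f

theorem add_pow_card_field (hq : Fintype.card F = q) (x y : K) :
    (x + y) ^ q = x ^ q + y ^ q := by
  subst hq
  exact map_add (FiniteField.frobeniusAlgHom F K) x y

theorem sub_pow_card_field (hq : Fintype.card F = q) (x y : K) :
    (x - y) ^ q = x ^ q - y ^ q := by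
  subst hq
  exact map_sub (FiniteField.frobeniusAlgHom F K) x y

theorem algebraMap_pow_card (hq : Fintype.card F = q) (a : F) :
    algebraMap F K a ^ q = algebraMap F K a := by
  rw [← map_pow, ← hq, FiniteField.pow_card]

theorem pow_card_pow_card (hq : Fintype.card F = q) (hK : Module.finrank F K = 2) (x : K) :
    (x ^ q) ^ q = x := by
  have : FiniteDimensional F K := Module.finite_of_finrank_pos (by omega)
  have : Finite K := Module.finite_of_finite F
  have := Fintype.ofFinite K
  have h := FiniteField.pow_card x
  rw [Module.card_eq_pow_finrank (K := F), hK, hq] at h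
  rw [← pow_mul, ← sq, h]

end Frobenius

/-! ### The evaluation points as representatives of conjugacy classes -/

section Listing

variable {F K : Type*} [Field F] [Fintype F] [Field K] [Algebra F K] {q r t : ℕ}
  {α : Fin q → F} {β : Fin r → K}

theorem IsListing.two_mul_add (hαβ : IsListing α β) (hq : Fintype.card F = q)
    (hK : Module.finrank F K = 2) : q + 2 * r = q ^ 2 := by
  have : FiniteDimensional F K := Module.finite_of_finrank_pos (by omega)
  have : Finite K := Module.finite_of_finite F
  have := Fintype.ofFinite K
  have h := Fintype.card_of_bijective hαβ
  rw [Module.card_eq_pow_finrank (K := F) (V := K), hK, hq] at h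
  rw [← h]
  simp
  ring

omit [Fintype F] in
theorem IsListing.beta_pow_ne (hαβ : IsListing α β) (j k : Fin r) : β j ^ q ≠ β k := fun h => by
  simpa using @hαβ.1 (Sum.inr (Sum.inr j)) (Sum.inr (Sum.inl k)) h

omit [Fintype F] in
theorem IsListing.beta_injective (hαβ : IsListing α β) : Function.Injective β := fun j k h => by
  simpa using @hαβ.1 (Sum.inr (Sum.inl j)) (Sum.inr (Sum.inl k)) h

omit [Fintype F] in
theorem IsListing.alpha_injective (hαβ : IsListing α β) : Function.Injective α := fun j k h => by
  simpa using @hαβ.1 (Sum.inl j) (Sum.inl k) (congrArg (algebraMap F K) h)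

omit [Fintype F] in
theorem IsListing.alpha_ne_beta (hαβ : IsListing α β) (j : Fin q) (k : Fin r) :
    algebraMap F K (α j) ≠ β k := fun h => by
  simpa using @hαβ.1 (Sum.inl j) (Sum.inr (Sum.inl k)) h

theorem IsListing.exists_beta (hαβ : IsListing α β) (hq : Fintype.card F = q) {x : K}
    (hx : x ^ q ≠ x) : ∃ j, β j = x ∨ β j ^ q = x := by
  obtain ⟨i | j | j, h⟩ := hαβ.2 x
  · exact absurd (h ▸ algebraMap_pow_card hq (α i)) hx
  · exact ⟨j, Or.inl h⟩
  · exact ⟨j, Or.inr h⟩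

theorem IsListing.exists_algebraMap (hαβ : IsListing α β) (hq : Fintype.card F = q)
    (hK : Module.finrank F K = 2) {x : K} (hx : x ^ q = x) : ∃ c, algebraMap F K c = x := by
  obtain ⟨i | j | j, h⟩ := hαβ.2 x
  · exact ⟨_, h⟩
  · have h' : β j = x := h
    exact absurd (h' ▸ hx) (hαβ.beta_pow_ne j j)
  · have h' : β j ^ q = x := h
    rw [← h', pow_card_pow_card hq hK] at hx
    exact absurd hx.symm (hαβ.beta_pow_ne j j)

omit [Fintype F] in
theorem evalPoints_castAdd (ht : t ≤ q) (i : Fin t) :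
    evalPoints α β ht (Fin.castAdd r i) = algebraMap F K (α (Fin.castLE ht i)) :=
  Fin.append_left _ _ _

omit [Fintype F] in
theorem evalPoints_natAdd (ht : t ≤ q) (j : Fin r) :
    evalPoints α β ht (Fin.natAdd t j) = β j :=
  Fin.append_right _ _ _

omit [Fintype F] in
theorem IsListing.evalPoints_injective (hαβ : IsListing α β) (ht : t ≤ q) :
    Function.Injective (evalPoints α β ht) := by
  intro i j
  refine Fin.addCases (fun i => ?_) (fun i => ?_) i <;>
    refine Fin.addCases (fun j => ?_) (fun j => ?_) j <;>
    simp only [evalPoints_castAdd, evalPoints_natAdd] <;> intro h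
  · rw [Fin.castLE_injective ht (hαβ.alpha_injective ((algebraMap F K).injective h))]
  · exact absurd h (hαβ.alpha_ne_beta _ _)
  · exact absurd h.symm (hαβ.alpha_ne_beta _ _)
  · rw [hαβ.beta_injective h]

theorem IsListing.eq_of_evalPoints_pow (hαβ : IsListing α β) (hq : Fintype.card F = q)
    (ht : t ≤ q) {i j : Fin (t + r)} (h : evalPoints α β ht i ^ q = evalPoints α β ht j) :
    i = j := by
  revert h
  refine Fin.addCases (fun i => ?_) (fun i => ?_) i
  · rw [evalPoints_castAdd, algebraMap_pow_card hq, ← evalPoints_castAdd (β := β)]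
    exact fun h => hαβ.evalPoints_injective ht h
  · refine Fin.addCases (fun j => ?_) (fun j => ?_) j
    · rw [evalPoints_castAdd, evalPoints_natAdd]
      exact fun h => by simpa using @hαβ.1 (Sum.inr (Sum.inr i)) (Sum.inl (Fin.castLE ht j)) h
    · rw [evalPoints_natAdd, evalPoints_natAdd]
      exact fun h => absurd h (hαβ.beta_pow_ne _ _)

end Listing

/-! ### Counting zeros at the evaluation points -/

section Zeros

variable {F K : Type*} [Field F] [Field K] [Algebra F K] {q r t : ℕ}

open Classical in
/-- The indices of the zeros of `f` among `α₁, …, α_t`. -/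
noncomputable def ratZeros (α : Fin q → F) (ht : t ≤ q) (f : F[X]) : Finset (Fin t) :=
  Finset.univ.filter fun i => f.eval (α (Fin.castLE ht i)) = 0

open Classical in
/-- The indices of the zeros of `f` among `β₁, …, β_r`. -/
noncomputable def conjZeros (β : Fin r → K) (f : F[X]) : Finset (Fin r) :=
  Finset.univ.filter fun j => aeval (β j) f = 0

variable {α : Fin q → F} {β : Fin r → K} {ht : t ≤ q}

theorem mem_ratZeros {f : F[X]} {i : Fin t} :
    i ∈ ratZeros α ht f ↔ f.eval (α (Fin.castLE ht i)) = 0 := by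
  simp [ratZeros]

theorem mem_conjZeros {f : F[X]} {j : Fin r} : j ∈ conjZeros β f ↔ aeval (β j) f = 0 := by
  simp [conjZeros]

theorem card_ratZeros_le (f : F[X]) : (ratZeros α ht f).card ≤ t :=
  (Finset.card_le_univ _).trans_eq (Fintype.card_fin t)

/-- A zero `β_j` counts twice: coefficients in `F` make its conjugate a root too, and all these
roots are distinct. -/
theorem card_zeros_le_natDegree [Fintype F] (hαβ : IsListing α β) (hq : Fintype.card F = q)
    {f : F[X]} (hf : f ≠ 0) :
    (ratZeros α ht f).card + 2 * (conjZeros β f).card ≤ f.natDegree := by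
  classical
  set S := (ratZeros α ht f).disjSum ((conjZeros β f).disjSum (conjZeros β f)) with hS
  have hcard : S.card = (ratZeros α ht f).card + 2 * (conjZeros β f).card := by
    rw [hS, Finset.card_disjSum, Finset.card_disjSum, two_mul]
  have hfK : f.map (algebraMap F K) ≠ 0 :=
    (Polynomial.map_ne_zero_iff (algebraMap F K).injective).2 hf
  have h1 : S.card ≤ (f.aroots K).toFinset.card := by
    refine Finset.card_le_card_of_injOn
      (fun x => (Sum.elim (fun i => algebraMap F K (α i)) (Sum.elim β (fun j => β j ^ q)) :
        Fin q ⊕ (Fin r ⊕ Fin r) → K) (Sum.map (Fin.castLE ht) id x)) ?_ ?_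
    · rintro (i | j | j) hx
      · have hx' : i ∈ ratZeros α ht f := by simpa [hS] using hx
        simpa [hf, aeval_algebraMap_apply] using mem_ratZeros.1 hx'
      · have hx' : j ∈ conjZeros β f := by simpa [hS] using hx
        simpa [hf] using mem_conjZeros.1 hx'
      · have hx' : j ∈ conjZeros β f := by simpa [hS] using hx
        have h0 := mem_conjZeros.1 hx'
        have hq0 : q ≠ 0 := by
          rw [← hq]
          exact Fintype.card_ne_zero
        simp [hf, aeval_pow_card hq, h0, hq0]
    · refine Function.Injective.injOn (hαβ.1.comp ?_)
      exact Function.Injective.sumMap (Fin.castLE_injective ht) Function.injective_id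
  calc _ = S.card := hcard.symm
    _ ≤ (f.aroots K).toFinset.card := h1
    _ ≤ Multiset.card (f.aroots K) := Multiset.toFinset_card_le _
    _ ≤ (f.map (algebraMap F K)).natDegree := card_roots' _
    _ = f.natDegree := natDegree_map _

theorem hammingNorm_add_card_zeros [DecidableEq F] {f : F[X]} {c : Fin (t + r) → F}
    (hc : ∀ i, algebraMap F K (c i) = aeval (evalPoints α β ht i) f) :
    hammingNorm c + ((ratZeros α ht f).card + (conjZeros β f).card) = t + r := by
  classical
  have h1 : (ratZeros α ht f).card + (conjZeros β f).card =
      (Finset.univ.filter fun i => c i = 0).card := by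
    rw [Finset.card_filter, Fin.sum_univ_add, ← Finset.card_filter, ← Finset.card_filter]
    congr 2
    · ext i
      have := hc (Fin.castAdd r i)
      rw [evalPoints_castAdd, aeval_algebraMap_apply, (algebraMap F K).injective.eq_iff] at this
      rw [mem_ratZeros, Finset.mem_filter, this]
      simp
    · ext j
      have := hc (Fin.natAdd t j)
      rw [evalPoints_natAdd] at this
      rw [mem_conjZeros, Finset.mem_filter, ← this]
      simp
  rw [h1, hammingNorm, add_comm]
  simpa using Finset.card_filter_add_card_filter_not (s := Finset.univ) (fun i => c i = 0)

end Zeros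

end AsymQuantum

namespace AsymQuantum

/-! ### Degree and conjugation invariance of the space `V_{m,ℓ}` -/

section Space

variable {F : Type*} [Field F] {q m l : ℕ}

theorem ePoly_self (q i : ℕ) : ePoly F q i i = X ^ (i * q + i) := if_pos rfl

theorem ePoly_of_ne {i j : ℕ} (q : ℕ) (h : i ≠ j) :
    ePoly F q i j = X ^ (i * q + j) + X ^ (j * q + i) := if_neg h

/-- Induction over the space `V_{m,ℓ}`. -/
theorem xlSpace_induction {p : F[X] → Prop}
    (low : ∀ i j, i ≤ j → j ≤ m - 2 → p (ePoly F q i j))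
    (top : ∀ i, i ≤ l → p (ePoly F q i (m - 1))) (zero : p 0)
    (add : ∀ f g, p f → p g → p (f + g)) (smul : ∀ (c : F) f, p f → p (c • f))
    {f : F[X]} (hf : f ∈ xlSpace F q m l) : p f := by
  induction hf using Submodule.span_induction with
  | mem x hx =>
    rcases hx with ⟨i, j, hij, hj, rfl⟩ | ⟨i, hi, rfl⟩
    · exact low i j hij hj
    · exact top i hi
  | zero => exact zero
  | add f g _ _ hf hg => exact add f g hf hg
  | smul c f _ hf => exact smul c f hf

theorem natDegree_ePoly_le {i j : ℕ} (q : ℕ) (hq : 0 < q) (hij : i ≤ j) :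
    (ePoly F q i j).natDegree ≤ j * q + i := by
  have h : i * q + j ≤ j * q + i := by
    obtain ⟨k, rfl⟩ := Nat.exists_eq_add_of_le hij
    nlinarith [Nat.mul_le_mul_left k hq]
  rcases eq_or_ne i j with rfl | hne
  · rw [ePoly_self, natDegree_X_pow]
  · rw [ePoly_of_ne q hne]
    refine (natDegree_add_le _ _).trans ?_
    rw [natDegree_X_pow, natDegree_X_pow]
    exact max_le h le_rfl

theorem natDegree_le_of_mem_xlSpace (hm : 2 ≤ m) (hmq : m ≤ q) (hl : l ≤ m - 1) {f : F[X]}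
    (hf : f ∈ xlSpace F q m l) : f.natDegree ≤ (m - 1) * q + l := by
  obtain ⟨k, rfl⟩ := Nat.exists_eq_add_of_le' hm
  refine xlSpace_induction (p := fun f => f.natDegree ≤ (k + 2 - 1) * q + l) ?_ ?_ ?_ ?_ ?_ hf
  · intro i j hij hj
    refine (natDegree_ePoly_le q (by omega) hij).trans ?_
    have h1 : j * q ≤ k * q := Nat.mul_le_mul_right q (by omega)
    have h2 : (k + 2 - 1) * q = k * q + q := by
      rw [show k + 2 - 1 = k + 1 by omega]
      ring
    omega
  · intro i hi
    exact (natDegree_ePoly_le q (by omega) (hi.trans hl)).trans (by omega)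
  · simp
  · exact fun f g hf hg => (natDegree_add_le f g).trans (max_le hf hg)
  · exact fun c f hf => (natDegree_smul_le c f).trans hf

theorem aeval_ePoly_pow_card {K : Type*} [Fintype F] [Field K] [Algebra F K]
    (hq : Fintype.card F = q) (hK : Module.finrank F K = 2) (i j : ℕ) (x : K) :
    aeval (x ^ q) (ePoly F q i j) = aeval x (ePoly F q i j) := by
  have key : ∀ i j : ℕ, (x ^ q) ^ (i * q + j) = x ^ (j * q + i) := fun i j => by
    calc (x ^ q) ^ (i * q + j) = ((x ^ q) ^ q) ^ i * (x ^ q) ^ j := by ring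
      _ = x ^ (j * q + i) := by rw [pow_card_pow_card hq hK]; ring
  rcases eq_or_ne i j with rfl | hne
  · simp only [ePoly_self, map_pow, aeval_X, key]
  · simp only [ePoly_of_ne q hne, map_add, map_pow, aeval_X, key]
    rw [add_comm]

theorem aeval_pow_card_of_mem_xlSpace {K : Type*} [Fintype F] [Field K] [Algebra F K]
    (hq : Fintype.card F = q) (hK : Module.finrank F K = 2) {f : F[X]}
    (hf : f ∈ xlSpace F q m l) (x : K) : aeval (x ^ q) f = aeval x f := by
  refine xlSpace_induction (p := fun f => aeval (x ^ q) f = aeval x f) ?_ ?_ ?_ ?_ ?_ hf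
  · exact fun i j _ _ => aeval_ePoly_pow_card hq hK i j x
  · exact fun i _ => aeval_ePoly_pow_card hq hK i _ x
  · simp
  · intro f g hf hg
    rw [map_add, map_add, hf, hg]
  · intro c f hf
    rw [map_smul, map_smul, hf]

end Space

/-! ### Reduction modulo `X^q - X` and its square -/

section Diagonal

variable {F : Type*} [Field F] {q m l : ℕ}

/-- A diagonal monomial, together with half of its derivative, describes `X^{iq+j} + X^{jq+i}`
modulo `(X^q - X)²`. -/
theorem sq_dvd_X_pow_add_X_pow (i j : ℕ) :
    ((X : F[X]) ^ q - X) ^ 2 ∣ X ^ (i * q + j) + X ^ (j * q + i) - 2 * X ^ (i + j) -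
      (X ^ q - X) * derivative (X ^ (i + j)) := by
  set T : F[X] := X ^ q - X with hT
  have hXq : (X : F[X]) ^ q = X + T := by rw [hT]; ring
  -- Both powers of `X^q = X + T` are expanded to first order in `T`.
  obtain ⟨a, ha⟩ := powAddExpansion (X : F[X]) T i
  obtain ⟨b, hb⟩ := powAddExpansion (X : F[X]) T j
  have key : ∀ i j : ℕ, (i : F[X]) * X ^ (i - 1) * X ^ j = (i : F[X]) * X ^ (i + j - 1) := by
    intro i j
    rcases i with _ | i
    · simp
    · rw [mul_assoc, ← pow_add]
      congr 2
      omega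
  have h1 : (X : F[X]) ^ (i * q + j) = X ^ (i + j) + (i : F[X]) * X ^ (i + j - 1) * T +
      a * X ^ j * T ^ 2 := by
    rw [← key, pow_add, mul_comm i q, pow_mul, hXq, ha]
    ring
  have h2 : (X : F[X]) ^ (j * q + i) = X ^ (i + j) + (j : F[X]) * X ^ (i + j - 1) * T +
      b * X ^ i * T ^ 2 := by
    rw [add_comm i j, ← key, pow_add, mul_comm j q, pow_mul, hXq, hb]
    ring
  refine ⟨a * X ^ j + b * X ^ i, ?_⟩
  rw [h1, h2, derivative_X_pow]
  simp only [Nat.cast_add, map_add, map_natCast]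
  ring

/-- Here `d` is the reduction of `e_{i,j}` under `X^q ↦ X`. The doubled form covers `i = j` and `i ≠
j` without dividing by 2, and it is linear in the pair `(e, d)`, hence passes to spans. -/
theorem exists_sq_dvd_ePoly (i j : ℕ) : ∃ d : F[X], d.natDegree ≤ i + j ∧
    (X ^ q - X) ^ 2 ∣ 2 * ePoly F q i j - 2 * d - (X ^ q - X) * derivative d := by
  have h := sq_dvd_X_pow_add_X_pow (F := F) (q := q) i j
  rcases eq_or_ne i j with rfl | hne
  · refine ⟨X ^ (i + i), natDegree_X_pow_le _, ?_⟩
    rw [ePoly_self]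
    convert h using 2
    ring
  · refine ⟨2 * X ^ (i + j), ?_, ?_⟩
    · refine natDegree_mul_le.trans ?_
      rw [natDegree_ofNat, natDegree_X_pow, zero_add]
    · rw [ePoly_of_ne q hne]
      refine (h.mul_left 2).trans (dvd_of_eq ?_)
      rw [derivative_mul, derivative_ofNat]
      ring

theorem exists_sq_dvd_of_mem_xlSpace {f : F[X]} (hf : f ∈ xlSpace F q m l) :
    ∃ d : F[X], d.natDegree ≤ max (2 * (m - 2)) (m - 1 + l) ∧
      (X ^ q - X) ^ 2 ∣ 2 * f - 2 * d - (X ^ q - X) * derivative d := by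
  refine xlSpace_induction (p := fun f => ∃ d : F[X], d.natDegree ≤
    max (2 * (m - 2)) (m - 1 + l) ∧
      (X ^ q - X) ^ 2 ∣ 2 * f - 2 * d - (X ^ q - X) * derivative d) ?_ ?_ ?_ ?_ ?_ hf
  · intro i j hij hj
    obtain ⟨d, hd, h⟩ := exists_sq_dvd_ePoly (F := F) (q := q) i j
    exact ⟨d, hd.trans (le_max_of_le_left (by omega)), h⟩
  · intro i hi
    obtain ⟨d, hd, h⟩ := exists_sq_dvd_ePoly (F := F) (q := q) i (m - 1)
    exact ⟨d, hd.trans (le_max_of_le_right (by omega)), h⟩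
  · exact ⟨0, by simp, by simp⟩
  · rintro f g ⟨d, hd, h⟩ ⟨d', hd', h'⟩
    refine ⟨d + d', (natDegree_add_le _ _).trans (max_le hd hd'), ?_⟩
    refine (h.add h').trans (dvd_of_eq ?_)
    rw [derivative_add]
    ring
  · rintro c f ⟨d, hd, h⟩
    refine ⟨c • d, (natDegree_smul_le c d).trans hd, ?_⟩
    refine (h.mul_left (C c)).trans (dvd_of_eq ?_)
    rw [derivative_smul, smul_eq_C_mul, smul_eq_C_mul, smul_eq_C_mul]
    ring

theorem dvd_X_pow_sub_X_pow (i j : ℕ) :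
    (X : F[X]) ^ q - X ∣ X ^ (i * q + j) - X ^ (i + j) := by
  have h := sub_dvd_pow_sub_pow ((X : F[X]) ^ q) X i
  refine (h.mul_right (X ^ j)).trans (dvd_of_eq ?_)
  rw [pow_add, mul_comm i q, pow_mul, pow_add]
  ring

theorem dvd_ePoly_of_ne [CharP F 2] {i j : ℕ} (hne : i ≠ j) :
    (X : F[X]) ^ q - X ∣ ePoly F q i j := by
  rw [ePoly_of_ne q hne]
  have h := (dvd_X_pow_sub_X_pow (F := F) (q := q) i j).sub (dvd_X_pow_sub_X_pow j i)
  refine h.trans (dvd_of_eq ?_)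
  rw [CharTwo.sub_eq_add (X ^ (i * q + j) - X ^ (i + j)), add_comm j i]
  rw [CharTwo.sub_eq_add, CharTwo.sub_eq_add, add_add_add_comm, CharTwo.add_self_eq_zero,
    add_zero]

/-- Modulo `X^q - X` the off-diagonal `e_{i,j}` vanish and `e_{i,i}` becomes `(X^i)²`. Squaring is
additive and every scalar is a square, so a combination of these is again a square. The index `m -
1` occurs on the diagonal only when `ℓ` reaches it. -/
theorem exists_dvd_sub_sq_of_mem_xlSpace [Finite F] [CharP F 2] {D : ℕ} (h1 : m - 2 ≤ D)
    (h2 : m - 1 ≤ l → m - 1 ≤ D) {f : F[X]}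
    (hf : f ∈ xlSpace F q m l) :
    ∃ d : F[X], d.natDegree ≤ D ∧ X ^ q - X ∣ f - d ^ 2 := by
  have hdiag : ∀ i, i ≤ D → ∃ d : F[X], d.natDegree ≤ D ∧
      X ^ q - X ∣ ePoly F q i i - d ^ 2 := by
    intro i hi
    refine ⟨X ^ i, (natDegree_X_pow_le i).trans hi, ?_⟩
    rw [ePoly_self, ← pow_mul, mul_two]
    exact dvd_X_pow_sub_X_pow i i
  have hoff : ∀ i j, i ≠ j → ∃ d : F[X], d.natDegree ≤ D ∧
      X ^ q - X ∣ ePoly F q i j - d ^ 2 := fun i j hij =>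
    ⟨0, by simp, by simpa using dvd_ePoly_of_ne hij⟩
  refine xlSpace_induction (p := fun f => ∃ d : F[X], d.natDegree ≤ D ∧
      X ^ q - X ∣ f - d ^ 2) ?_ ?_ ?_ ?_ ?_ hf
  · intro i j hij hj
    rcases eq_or_ne i j with rfl | hne
    · exact hdiag i (hj.trans h1)
    · exact hoff i j hne
  · intro i hi
    rcases eq_or_ne i (m - 1) with rfl | hne
    · exact hdiag _ (h2 hi)
    · exact hoff i _ hne
  · exact ⟨0, by simp, by simp⟩
  · rintro f g ⟨d, hd, h⟩ ⟨d', hd', h'⟩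
    refine ⟨d + d', (natDegree_add_le _ _).trans (max_le hd hd'), ?_⟩
    rw [CharTwo.add_sq, add_sub_add_comm]
    exact h.add h'
  · rintro c f ⟨d, hd, h⟩
    obtain ⟨b, hb⟩ := FiniteField.isSquare_of_char_two
      (CharP.ringChar_of_prime_eq_zero Nat.prime_two (CharP.cast_eq_zero F 2)) c
    refine ⟨C b * d, (natDegree_C_mul_le _ _).trans hd, ?_⟩
    refine (h.mul_left (C c)).trans (dvd_of_eq ?_)
    rw [smul_eq_C_mul, hb, C_mul]
    ring

end Diagonal

end AsymQuantum

namespace AsymQuantum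

/-! ### The designed distance -/

section Distance

variable {F K : Type*} [Field F] [Fintype F] [Field K] [Algebra F K] {q r t m l : ℕ}
  {α : Fin q → F} {β : Fin r → K} {ht : t ≤ q}

theorem two_mul_card_conjZeros_add_le (hαβ : IsListing α β) (hq : Fintype.card F = q)
    {f h : F[X]} (hf : f ≠ 0) (e : ℕ) (hfh : f = (X ^ q - X) ^ e * h) :
    2 * (conjZeros β f).card + e * q ≤ f.natDegree := by
  have hq1 : 1 < q := hq ▸ Fintype.one_lt_card
  have hT : (X ^ q - X : F[X]) ≠ 0 := FiniteField.X_pow_card_sub_X_ne_zero F hq1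
  have hh : h ≠ 0 := fun h0 => hf (by rw [hfh, h0, mul_zero])
  have hsub : conjZeros β f ⊆ conjZeros β h := by
    intro j hj
    rw [mem_conjZeros, hfh, map_mul] at hj
    refine mem_conjZeros.2 ((mul_eq_zero.1 hj).resolve_left ?_)
    rw [map_pow]
    refine pow_ne_zero _ ?_
    simpa [sub_eq_zero] using hαβ.beta_pow_ne j j
  have h1 := Finset.card_le_card hsub
  -- Length `t = 0` drops the rational points from the count.
  have h2 := card_zeros_le_natDegree (ht := Nat.zero_le q) hαβ hq hh
  have h3 : f.natDegree = e * q + h.natDegree := by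
    rw [hfh, natDegree_mul (pow_ne_zero _ hT) hh, natDegree_pow,
      FiniteField.X_pow_card_sub_X_natDegree_eq F hq1]
  omega

theorem card_ratZeros_le_natDegree (hαβ : IsListing α β) (hq : Fintype.card F = q)
    {f d : F[X]} (hd : d ≠ 0)
    (h : ∀ a : F, f.eval a = 0 → d.eval a = 0) :
    (ratZeros α ht f).card ≤ d.natDegree := by
  have hsub : ratZeros α ht f ⊆ ratZeros α ht d := fun i hi =>
    mem_ratZeros.2 (h _ (mem_ratZeros.1 hi))
  have h1 := Finset.card_le_card hsub
  have h2 := card_zeros_le_natDegree (ht := ht) hαβ hq hd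
  omega

theorem eval_X_pow_card_sub_X (hq : Fintype.card F = q) (a : F) :
    (X ^ q - X : F[X]).eval a = 0 := by
  rw [eval_sub, eval_pow, eval_X, ← hq, FiniteField.pow_card, sub_self]

/-- If `d = 0`, then `T² ∣ f` gives `2B ≤ deg f - 2q`, which outweighs `A ≤ t ≤ q`. Otherwise `A ≤
min (deg d) t` is added to `A + 2B ≤ deg f`. -/
theorem two_mul_card_zeros_le_of_odd (hαβ : IsListing α β) (hq : Fintype.card F = q)
    (hodd : Odd q) (hm : 2 ≤ m) (hmq : m ≤ q) (hl : l ≤ m - 1)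
    {f : F[X]} (hf : f ∈ xlSpace F q m l) (hf0 : f ≠ 0) :
    2 * ((ratZeros α ht f).card + (conjZeros β f).card) ≤
      (m - 1) * q + l + min (max (2 * (m - 2)) (m - 1 + l)) t := by
  have h2 : (2 : F) ≠ 0 := by
    refine Ring.two_ne_zero fun hc => ?_
    have := FiniteField.even_card_iff_char_two.1 hc
    rw [hq] at this
    exact Nat.not_even_iff_odd.2 hodd (Nat.even_iff.2 this)
  have hdeg := natDegree_le_of_mem_xlSpace hm hmq hl hf
  have hA := card_ratZeros_le (α := α) (ht := ht) f
  obtain ⟨d, hd, hdvd⟩ := exists_sq_dvd_of_mem_xlSpace hf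
  rcases eq_or_ne d 0 with rfl | hd0
  · have : (X ^ q - X : F[X]) ^ 2 ∣ f := by
      have h3 : (X ^ q - X : F[X]) ^ 2 ∣ C 2⁻¹ * (2 * f) := Dvd.dvd.mul_left (by simpa using hdvd) _
      have h4 : C (2⁻¹ : F) * (2 * f) = f := by
        rw [← mul_assoc, show (2 : F[X]) = C 2 from rfl, ← C_mul, inv_mul_cancel₀ h2, C_1, one_mul]
      rwa [h4] at h3
    obtain ⟨h, hh⟩ := this
    have := two_mul_card_conjZeros_add_le hαβ hq hf0 2 hh
    omega
  · have h1 := card_zeros_le_natDegree (ht := ht) hαβ hq hf0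
    have h3 : (ratZeros α ht f).card ≤ d.natDegree := by
      refine card_ratZeros_le_natDegree hαβ hq hd0 fun a ha => ?_
      obtain ⟨k, hk⟩ := hdvd
      have := congrArg (eval a) hk
      have hT := eval_X_pow_card_sub_X hq a
      simp only [eval_sub, eval_mul, eval_pow, eval_X, eval_ofNat] at this hT
      rw [ha, hT] at this
      simpa [h2] using this
    have := le_min (h3.trans hd) hA
    omega

/-- Only one factor `T` is available when `d = 0`, so `2B ≤ deg f - q`; with `A ≤ t` this produces
the alternative `2t - q`. -/
theorem two_mul_card_zeros_le_of_even (hαβ : IsListing α β) (hq : Fintype.card F = q)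
    (heven : Even q) (hm : 2 ≤ m) (hmq : m ≤ q) (hl : l ≤ m - 1) {D : ℕ} (hD1 : m - 2 ≤ D)
    (hD2 : m - 1 ≤ l → m - 1 ≤ D)
    {f : F[X]} (hf : f ∈ xlSpace F q m l) (hf0 : f ≠ 0) :
    2 * ((ratZeros α ht f).card + (conjZeros β f).card) ≤
      (m - 1) * q + l + max (min D t) (2 * t - q) := by
  have : CharP F 2 := by
    have h2 : ringChar F = 2 :=
      FiniteField.even_card_iff_char_two.2 (by rw [hq]; exact Nat.even_iff.1 heven)
    exact h2 ▸ ringChar.charP F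
  have hdeg := natDegree_le_of_mem_xlSpace hm hmq hl hf
  have hA := card_ratZeros_le (α := α) (ht := ht) f
  obtain ⟨d, hd, hdvd⟩ := exists_dvd_sub_sq_of_mem_xlSpace hD1 hD2 hf
  rcases eq_or_ne d 0 with rfl | hd0
  · obtain ⟨h, hh⟩ : (X ^ q - X : F[X]) ∣ f := by simpa using hdvd
    have := two_mul_card_conjZeros_add_le hαβ hq hf0 1 (by rw [pow_one]; exact hh)
    omega
  · have h1 := card_zeros_le_natDegree (ht := ht) hαβ hq hf0
    have h3 : (ratZeros α ht f).card ≤ d.natDegree := by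
      refine card_ratZeros_le_natDegree hαβ hq hd0 fun a ha => ?_
      obtain ⟨k, hk⟩ := hdvd
      have := congrArg (eval a) hk
      have hT := eval_X_pow_card_sub_X hq a
      simp only [eval_sub, eval_mul, eval_pow, eval_X] at this hT
      rw [ha, hT] at this
      simpa using this
    have := le_min (h3.trans hd) hA
    omega

theorem two_mul_card_zeros_le (hαβ : IsListing α β) (hq : Fintype.card F = q)
    (hm : 2 ≤ m) (hmq : m ≤ q) (hl : l ≤ m - 1)
    {f : F[X]} (hf : f ∈ xlSpace F q m l) (hf0 : f ≠ 0) :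
    2 * (((ratZeros α ht f).card : ℤ) + (conjZeros β f).card) ≤
      q * (m - 1) + l + gParam q t m l := by
  have hcast : (((m - 1) * q : ℕ) : ℤ) = q * (m - 1) := by
    rw [Nat.cast_mul, Nat.cast_sub (by omega), mul_comm]
    simp
  rw [← hcast, gParam]
  generalize hX : (m - 1) * q = N
  split_ifs with h1 h2
  · have := two_mul_card_zeros_le_of_odd (ht := ht) hαβ hq h1 hm hmq hl hf hf0
    rw [hX] at this
    omega
  · have := two_mul_card_zeros_le_of_even (ht := ht) hαβ hq (Nat.not_odd_iff_even.1 h1) hm hmq hl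
      (D := m - 2) le_rfl (by omega) hf hf0
    rw [hX] at this
    omega
  · have := two_mul_card_zeros_le_of_even (ht := ht) hαβ hq (Nat.not_odd_iff_even.1 h1) hm hmq hl
      (D := m - 1) (by omega) (fun _ => le_rfl) hf hf0
    rw [hX] at this
    omega

theorem designDist_le_hammingNorm [DecidableEq F] (hαβ : IsListing α β)
    (hq : Fintype.card F = q) (hK : Module.finrank F K = 2)
    (hm : 2 ≤ m) (hmq : m ≤ q) (hl : l ≤ m - 1) {c : Fin (t + r) → F}
    (hc : c ∈ evalCode (xlSpace F q m l) (evalPoints α β ht)) (hc0 : c ≠ 0) :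
    designDist q t m l ≤ hammingNorm c := by
  obtain ⟨f, hf, hfc⟩ := hc
  have hf0 : f ≠ 0 := by
    rintro rfl
    exact hc0 (funext fun i => by simpa using hfc i)
  have h1 := hammingNorm_add_card_zeros hfc
  have h2 := two_mul_card_zeros_le (ht := ht) hαβ hq hm hmq hl hf hf0
  have h3 := hαβ.two_mul_add hq hK
  have h1' : (hammingNorm c : ℚ) + ((ratZeros α ht f).card + (conjZeros β f).card) = t + r := by
    exact_mod_cast h1
  have h2' : 2 * (((ratZeros α ht f).card : ℚ) + (conjZeros β f).card) ≤
      q * (m - 1) + l + gParam q t m l := by exact_mod_cast h2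
  have h3' : (q : ℚ) + 2 * r = q ^ 2 := by exact_mod_cast h3
  rw [designDist]
  linarith

theorem eq_zero_of_forall_aeval_evalPoints_eq_zero (hαβ : IsListing α β)
    (hq : Fintype.card F = q) (hK : Module.finrank F K = 2)
    (hm : 2 ≤ m) (hmq : m ≤ q - 1) (hl : l ≤ m - 1) {f : F[X]}
    (hf : f ∈ xlSpace F q m l) (h : ∀ i, aeval (evalPoints α β ht i) f = 0) : f = 0 := by
  by_contra hf0
  have h1 := card_zeros_le_natDegree (ht := ht) hαβ hq hf0
  have h2 : conjZeros β f = Finset.univ := by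
    ext j
    have := h (Fin.natAdd t j)
    rw [evalPoints_natAdd] at this
    simpa [mem_conjZeros] using this
  rw [h2, Finset.card_univ, Fintype.card_fin] at h1
  have h3 := hαβ.two_mul_add hq hK
  have h4 := natDegree_le_of_mem_xlSpace hm (by omega) hl hf
  obtain ⟨k, rfl⟩ : ∃ k, q = k + 2 := ⟨q - 2, by omega⟩
  -- The degree is at most `(q - 2) q + (q - 2) = q² - q - 2`, below the `2r = q² - q` roots formed
  -- by the `β_j` and their conjugates.
  have h5 : (m - 1) * (k + 2) ≤ k * (k + 2) := Nat.mul_le_mul_right _ (by omega)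
  have h6 : l ≤ k := by omega
  nlinarith

end Distance

/-! ### Bases and dimensions of `V_{m,ℓ}` and `W₅` -/

section Dimension

variable {F : Type*} [Field F] {q m l : ℕ}

theorem eq_and_eq_of_mul_add_eq {a b c d : ℕ} (hb : b < q) (hd : d < q)
    (h : a * q + b = c * q + d) : a = c ∧ b = d := by
  have h1 := congrArg (· / q) h
  have h2 := congrArg (· % q) h
  have hq : 0 < q := by omega
  simp only [Nat.mul_add_mod', Nat.mod_eq_of_lt hb, Nat.mod_eq_of_lt hd] at h2
  refine ⟨?_, h2⟩
  rw [h2] at h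
  exact Nat.eq_of_mul_eq_mul_right hq (Nat.add_right_cancel h)

/-- Exponents are read in base `q`: the mirror monomial `X^{iq+j}` with `i < j` has its digits in
the wrong order, so these coefficients form a dual family to the `e_{i,j}`. -/
theorem coeff_ePoly {i j i' j' : ℕ} (hij : i ≤ j) (hj : j < q) (hij' : i' ≤ j') (hj' : j' < q) :
    (ePoly F q i j).coeff (j' * q + i') = if i = i' ∧ j = j' then 1 else 0 := by
  rcases eq_or_ne i j with rfl | hne
  · rw [ePoly_self, coeff_X_pow]
    refine if_congr ⟨fun h => ?_, ?_⟩ rfl rfl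
    · have := eq_and_eq_of_mul_add_eq (by omega) hj h
      omega
    · rintro ⟨rfl, rfl⟩
      rfl
  · rw [ePoly_of_ne q hne, coeff_add, coeff_X_pow, coeff_X_pow, if_neg, zero_add]
    · refine if_congr ⟨fun h => ?_, ?_⟩ rfl rfl
      · have := eq_and_eq_of_mul_add_eq (by omega) (by omega) h
        omega
      · rintro ⟨rfl, rfl⟩
        rfl
    · intro h
      have := eq_and_eq_of_mul_add_eq (by omega) (by omega) h
      omega

/-- A finite set of pairs `⟨j, i⟩` with `i ≤ j < q` spans a space of polynomials `e_{i,j}` of the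
same size. -/
theorem finrank_span_ePoly (I : Finset (Σ _ : ℕ, ℕ)) (hI : ∀ p ∈ I, p.2 ≤ p.1 ∧ p.1 < q) :
    Module.finrank F (Submodule.span F ((fun p : Σ _ : ℕ, ℕ => ePoly F q p.2 p.1) '' I)) =
      I.card := by
  have hli : LinearIndependent F (fun p : I => ePoly F q p.1.2 p.1.1) := by
    rw [linearIndependent_iff']
    intro s g hg p hp
    have h1 := congrArg (fun f => coeff f (p.1.1 * q + p.1.2)) hg
    simp only [finsetSum_coeff, coeff_smul, coeff_zero, smul_eq_mul] at h1
    rw [Finset.sum_eq_single p] at h1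
    · rw [coeff_ePoly (hI _ p.2).1 (hI _ p.2).2 (hI _ p.2).1 (hI _ p.2).2] at h1
      simpa using h1
    · intro b _ hbp
      rw [coeff_ePoly (hI _ b.2).1 (hI _ b.2).2 (hI _ p.2).1 (hI _ p.2).2, if_neg, mul_zero]
      exact fun hc => hbp (Subtype.ext (Sigma.ext hc.2 (heq_of_eq hc.1)))
    · exact fun hc => absurd hp hc
  have := finrank_span_eq_card hli
  rw [Fintype.card_coe] at this
  rw [← this, Set.image_eq_range]
  rfl

/-- The index pairs `⟨j, i⟩` of the basis of `V_{m,ℓ}`. -/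
def xlIndex (m l : ℕ) : Finset (Σ _ : ℕ, ℕ) :=
  (Finset.range m).sigma fun j => Finset.range (if j = m - 1 then l + 1 else j + 1)

theorem mem_xlIndex {p : Σ _ : ℕ, ℕ} :
    p ∈ xlIndex m l ↔ p.1 < m ∧ p.2 < if p.1 = m - 1 then l + 1 else p.1 + 1 := by
  rw [xlIndex, Finset.mem_sigma, Finset.mem_range, Finset.mem_range]

theorem card_xlIndex (hm : 1 ≤ m) : (xlIndex m l).card = m * (m - 1) / 2 + l + 1 := by
  obtain ⟨k, rfl⟩ := Nat.exists_eq_add_of_le' hm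
  rw [xlIndex, Finset.card_sigma, Finset.sum_range_succ, ← Finset.sum_range_id_mul_two,
    Nat.mul_div_cancel _ two_pos, Finset.sum_range_succ']
  have : ∀ j ∈ Finset.range k,
      (Finset.range (if j = k + 1 - 1 then l + 1 else j + 1)).card = j + 1 := by
    intro j hj
    rw [Finset.mem_range] at hj
    rw [if_neg (by omega), Finset.card_range]
  rw [Finset.sum_congr rfl this]
  simp
  ring

theorem ePoly_mem_xlSpace {i j : ℕ} (hij : i ≤ j) (h : j ≤ m - 2 ∨ j = m - 1 ∧ i ≤ l) :
    ePoly F q i j ∈ xlSpace F q m l := by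
  rcases h with h | ⟨rfl, h⟩
  · exact Submodule.subset_span (Or.inl ⟨i, j, hij, h, rfl⟩)
  · exact Submodule.subset_span (Or.inr ⟨i, h, rfl⟩)

theorem xlSpace_eq_span (hm : 2 ≤ m) :
    xlSpace F q m l =
      Submodule.span F ((fun p : Σ _ : ℕ, ℕ => ePoly F q p.2 p.1) '' xlIndex m l) := by
  refine le_antisymm (Submodule.span_le.2 ?_) (Submodule.span_le.2 ?_)
  · rintro f (⟨i, j, hij, hj, rfl⟩ | ⟨i, hi, rfl⟩)
    · refine Submodule.subset_span ⟨⟨j, i⟩, ?_, rfl⟩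
      rw [Finset.mem_coe, mem_xlIndex]
      dsimp only
      rw [if_neg (by omega)]
      omega
    · refine Submodule.subset_span ⟨⟨m - 1, i⟩, ?_, rfl⟩
      rw [Finset.mem_coe, mem_xlIndex]
      dsimp only
      rw [if_pos rfl]
      omega
  · rintro _ ⟨⟨j, i⟩, hp, rfl⟩
    rw [Finset.mem_coe, mem_xlIndex] at hp
    dsimp only at hp ⊢
    split_ifs at hp with h
    · exact Submodule.subset_span (Or.inr ⟨i, by omega, by rw [h]⟩)
    · exact ePoly_mem_xlSpace (by omega) (Or.inl (by omega))

theorem finrank_xlSpace (hm : 2 ≤ m) (hmq : m ≤ q) (hl : l ≤ m - 1) :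
    Module.finrank F (xlSpace F q m l) = m * (m - 1) / 2 + l + 1 := by
  rw [xlSpace_eq_span hm, finrank_span_ePoly, card_xlIndex (by omega)]
  intro p hp
  rw [mem_xlIndex] at hp
  split_ifs at hp <;> omega

theorem ePoly_zero_zero : ePoly F q 0 0 = 1 := by simp [ePoly_self]

theorem ePoly_zero_one : ePoly F q 0 1 = X ^ q + X := by
  simp [ePoly_of_ne q zero_ne_one, add_comm]

theorem ePoly_one_one : ePoly F q 1 1 = X ^ (q + 1) := by simp [ePoly_self]

theorem ePoly_two_two : ePoly F q 2 2 = X ^ (2 * (q + 1)) := by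
  rw [ePoly_self]
  congr 1

theorem ePoly_zero_two : ePoly F q 0 2 = (X ^ q + X) ^ 2 - 2 * X ^ (q + 1) := by
  rw [ePoly_of_ne q (by norm_num)]
  ring

theorem ePoly_one_two : ePoly F q 1 2 = (X ^ q + X) * X ^ (q + 1) := by
  rw [ePoly_of_ne q (by norm_num)]
  ring

/-- The index pairs `⟨j, i⟩` of a basis of `W₅`. -/
def wFiveIndex : Finset (Σ _ : ℕ, ℕ) := {⟨0, 0⟩, ⟨1, 0⟩, ⟨2, 0⟩, ⟨1, 1⟩, ⟨2, 2⟩}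

/-- The generator `(X^q + X)²` equals `e_{0,2} + 2 e_{1,1}`, so this change of basis is valid in
every characteristic. -/
theorem wFive_eq_span :
    wFive F q = Submodule.span F ((fun p : Σ _ : ℕ, ℕ => ePoly F q p.2 p.1) '' wFiveIndex) := by
  have himg : ((fun p : Σ _ : ℕ, ℕ => ePoly F q p.2 p.1) '' wFiveIndex) =
      {1, X ^ q + X, (X ^ q + X) ^ 2 - 2 * X ^ (q + 1), X ^ (q + 1), X ^ (2 * (q + 1))} := by
    simp [wFiveIndex, Set.image_insert_eq, ePoly_zero_zero, ePoly_zero_one, ePoly_zero_two,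
      ePoly_one_one, ePoly_two_two]
  rw [himg, wFive]
  have htwo : ∀ g : F[X], 2 * g = (2 : F) • g := fun g => by rw [smul_eq_C_mul]; rfl
  refine le_antisymm (Submodule.span_le.2 ?_) (Submodule.span_le.2 ?_)
  · rintro f (rfl | rfl | rfl | rfl | rfl)
    · exact Submodule.subset_span (by simp)
    · exact Submodule.subset_span (by simp)
    · rw [← sub_add_cancel ((X ^ q + X : F[X]) ^ 2) (2 * X ^ (q + 1)), htwo]
      refine Submodule.add_mem _ ?_ (Submodule.smul_mem _ _ ?_)
      · rw [← htwo]
        exact Submodule.subset_span (by simp)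
      · exact Submodule.subset_span (by simp)
    · exact Submodule.subset_span (by simp)
    · exact Submodule.subset_span (by simp)
  · rintro f (rfl | rfl | rfl | rfl | rfl)
    · exact Submodule.subset_span (by simp)
    · exact Submodule.subset_span (by simp)
    · rw [htwo]
      refine Submodule.sub_mem _ ?_ (Submodule.smul_mem _ _ ?_)
      · exact Submodule.subset_span (by simp)
      · exact Submodule.subset_span (by simp)
    · exact Submodule.subset_span (by simp)
    · exact Submodule.subset_span (by simp)

theorem finrank_wFive (hq : 3 ≤ q) : Module.finrank F (wFive F q) = 5 := by
  rw [wFive_eq_span, finrank_span_ePoly]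
  · rfl
  · intro p hp
    simp only [wFiveIndex, Finset.mem_insert, Finset.mem_singleton] at hp
    rcases hp with rfl | rfl | rfl | rfl | rfl <;> dsimp only <;> omega

theorem wFive_le_xlSpace (h : 4 ≤ m ∨ m = 3 ∧ 2 ≤ l) : wFive F q ≤ xlSpace F q m l := by
  rw [wFive_eq_span, Submodule.span_le]
  rintro _ ⟨p, hp, rfl⟩
  rw [Finset.mem_coe] at hp
  simp only [wFiveIndex, Finset.mem_insert, Finset.mem_singleton] at hp
  rcases hp with rfl | rfl | rfl | rfl | rfl <;> dsimp only <;>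
    exact ePoly_mem_xlSpace (by omega) (by omega)

end Dimension

/-! ### Evaluation codes -/

section EvalCode

variable {F K : Type*} [Field F] [Field K] [Algebra F K] {ι : Type*}

theorem evalCode_mono {V W : Submodule F F[X]} (h : V ≤ W) (P : ι → K) :
    evalCode V P ≤ evalCode W P := by
  rintro c ⟨f, hf, hc⟩
  exact ⟨f, h hf, hc⟩

theorem finrank_evalCode {V : Submodule F F[X]} {P : ι → K}
    (hval : ∀ f ∈ V, ∀ i, ∃ c : F, algebraMap F K c = aeval (P i) f)
    (hinj : ∀ f ∈ V, (∀ i, aeval (P i) f = 0) → f = 0) :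
    Module.finrank F (evalCode V P) = Module.finrank F V := by
  choose c hc using fun f : V => hval f.1 f.2
  let L : V →ₗ[F] evalCode V P :=
    { toFun := fun f => ⟨c f, f.1, f.2, hc f⟩
      map_add' := fun f g => Subtype.ext <| funext fun i => (algebraMap F K).injective <| by
        simp [hc]
      map_smul' := fun a f => Subtype.ext <| funext fun i => (algebraMap F K).injective <| by
        simp [hc, Algebra.smul_def] }
  have hL : ∀ f i, algebraMap F K ((L f).1 i) = aeval (P i) f.1 := hc
  refine (LinearEquiv.ofBijective L ⟨?_, ?_⟩).finrank_eq.symm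
  · rw [← LinearMap.ker_eq_bot, LinearMap.ker_eq_bot']
    intro f hf
    refine Subtype.ext (hinj f.1 f.2 fun i => ?_)
    rw [← hL, hf]
    simp
  · rintro ⟨u, f, hf, hu⟩
    refine ⟨⟨f, hf⟩, Subtype.ext <| funext fun i => (algebraMap F K).injective ?_⟩
    rw [hL, hu]

end EvalCode

end AsymQuantum

namespace AsymQuantum

/-! ### Trace and norm coordinates, and words of weight four -/

section Coordinates

variable {F K : Type*} [Field F] [Fintype F] [Field K] [Algebra F K] {q r t m l : ℕ}
  {α : Fin q → F} {β : Fin r → K} {ht : t ≤ q}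

/-- `s` and `p` are the traces and the norms of the points `P`. -/
structure IsTraceNorm {ι : Type*} (q : ℕ) (P : ι → K) (s p : ι → F) : Prop where
  trace : ∀ i, algebraMap F K (s i) = P i + P i ^ q
  norm : ∀ i, algebraMap F K (p i) = P i * P i ^ q

theorem IsListing.exists_trace (hαβ : IsListing α β) (hq : Fintype.card F = q)
    (hK : Module.finrank F K = 2) (x : K) : ∃ a, algebraMap F K a = x + x ^ q :=
  hαβ.exists_algebraMap hq hK (by
    rw [add_pow_card_field hq, pow_card_pow_card hq hK, add_comm])

theorem IsListing.exists_norm (hαβ : IsListing α β) (hq : Fintype.card F = q)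
    (hK : Module.finrank F K = 2) (x : K) : ∃ a, algebraMap F K a = x * x ^ q :=
  hαβ.exists_algebraMap hq hK (by rw [mul_pow, pow_card_pow_card hq hK, mul_comm])

theorem IsListing.exists_isTraceNorm (hαβ : IsListing α β) (hq : Fintype.card F = q)
    (hK : Module.finrank F K = 2) (ht : t ≤ q) :
    ∃ s p : Fin (t + r) → F, IsTraceNorm q (evalPoints α β ht) s p := by
  choose s hs using fun i => hαβ.exists_trace hq hK (evalPoints α β ht i)
  choose p hp using fun i => hαβ.exists_norm hq hK (evalPoints α β ht i)
  exact ⟨s, p, hs, hp⟩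

variable {s p : Fin (t + r) → F}

theorem IsTraceNorm.eq_of_eq (h : IsTraceNorm q (evalPoints α β ht) s p)
    (hαβ : IsListing α β) (hq : Fintype.card F = q) {i j : Fin (t + r)}
    (hs : s i = s j) (hp : p i = p j) : i = j := by
  have h1 := congrArg (algebraMap F K) hs
  have h2 := congrArg (algebraMap F K) hp
  rw [h.trace, h.trace] at h1
  rw [h.norm, h.norm] at h2
  -- Trace and norm determine the quadratic polynomial whose roots are a point and its conjugate;
  -- the listing contains only one point of each such pair.
  have h3 : (evalPoints α β ht j - evalPoints α β ht i) *
      (evalPoints α β ht j - evalPoints α β ht i ^ q) = 0 := by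
    linear_combination (-evalPoints α β ht j) * h1 + h2
  rcases mul_eq_zero.1 h3 with h4 | h4
  · exact hαβ.evalPoints_injective ht (sub_eq_zero.1 h4).symm
  · exact hαβ.eq_of_evalPoints_pow hq ht (sub_eq_zero.1 h4).symm

theorem IsTraceNorm.exists_index (h : IsTraceNorm q (evalPoints α β ht) s p)
    (hαβ : IsListing α β) (hq : Fintype.card F = q) (hK : Module.finrank F K = 2) {x : K}
    (hx : x ^ q ≠ x) {a b : F} (ha : algebraMap F K a = x + x ^ q)
    (hb : algebraMap F K b = x * x ^ q) : ∃ i, s i = a ∧ p i = b := by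
  obtain ⟨j, hj⟩ := hαβ.exists_beta hq hx
  have h1 := h.trace (Fin.natAdd t j)
  have h2 := h.norm (Fin.natAdd t j)
  rw [evalPoints_natAdd] at h1 h2
  refine ⟨Fin.natAdd t j, (algebraMap F K).injective ?_, (algebraMap F K).injective ?_⟩
  · rw [h1, ha]
    rcases hj with rfl | rfl
    · rfl
    · rw [pow_card_pow_card hq hK, add_comm]
  · rw [h2, hb]
    rcases hj with rfl | rfl
    · rfl
    · rw [pow_card_pow_card hq hK, mul_comm]

omit [Fintype F] in
theorem IsTraceNorm.mem_dualCode_wFive_iff (h : IsTraceNorm q (evalPoints α β ht) s p)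
    (u : Fin (t + r) → F) :
    u ∈ dualCode (evalCode (wFive F q) (evalPoints α β ht)) ↔
      ∑ i, u i = 0 ∧ ∑ i, u i * s i = 0 ∧ ∑ i, u i * s i ^ 2 = 0 ∧ ∑ i, u i * p i = 0 ∧
        ∑ i, u i * p i ^ 2 = 0 := by
  constructor
  · intro hu
    have key : ∀ f ∈ wFive F q, ∀ c : Fin (t + r) → F,
        (∀ i, algebraMap F K (c i) = aeval (evalPoints α β ht i) f) → ∑ i, u i * c i = 0 :=
      fun f hf c hc => hu c ⟨f, hf, hc⟩
    refine ⟨?_, ?_, ?_, ?_, ?_⟩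
    · simpa using key 1 (Submodule.subset_span (by simp)) (fun _ => 1) (by simp)
    · exact key (X ^ q + X) (Submodule.subset_span (by simp)) s
        (fun i => by simp [h.trace, add_comm])
    · exact key ((X ^ q + X) ^ 2) (Submodule.subset_span (by simp)) (fun i => s i ^ 2)
        (fun i => by simp [h.trace, add_comm])
    · exact key (X ^ (q + 1)) (Submodule.subset_span (by simp)) p
        (fun i => by simp [h.norm, pow_succ, mul_comm])
    · exact key (X ^ (2 * (q + 1))) (Submodule.subset_span (by simp)) (fun i => p i ^ 2)
        (fun i => by simp [h.norm]; ring)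
  · rintro ⟨h1, h2, h3, h4, h5⟩ c ⟨f, hf, hc⟩
    have toK : ∀ v : Fin (t + r) → F, ∑ i, u i * v i = 0 →
        ∑ i, algebraMap F K (u i) * algebraMap F K (v i) = 0 := fun v hv => by
      simpa using congrArg (algebraMap F K) hv
    have key : ∑ i, algebraMap F K (u i) * aeval (evalPoints α β ht i) f = 0 := by
      clear hc
      induction hf using Submodule.span_induction with
      | mem f hf =>
        rcases hf with rfl | rfl | rfl | rfl | rfl
        · simpa using toK 1 (by simpa using h1)
        · rw [← toK s h2]
          refine Finset.sum_congr rfl fun i _ => ?_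
          simp [h.trace, add_comm]
        · rw [← toK (fun i => s i ^ 2) h3]
          refine Finset.sum_congr rfl fun i _ => ?_
          simp [h.trace, add_comm]
        · rw [← toK p h4]
          refine Finset.sum_congr rfl fun i _ => ?_
          simp [h.norm, pow_succ, mul_comm]
        · rw [← toK (fun i => p i ^ 2) h5]
          refine Finset.sum_congr rfl fun i _ => ?_
          simp only [map_pow, aeval_X, h.norm]
          ring
      | zero => simp
      | add f g _ _ hf hg =>
        simp only [map_add, mul_add, Finset.sum_add_distrib, hf, hg, add_zero]
      | smul a f _ hf =>
        simp only [map_smul, mul_smul_comm, ← Finset.smul_sum, hf, smul_zero]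
    refine (algebraMap F K).injective ?_
    rw [dotProduct, map_sum, map_zero, ← key]
    exact Finset.sum_congr rfl fun i _ => by rw [map_mul, hc]

omit [Fintype F] in
/-- A function `a + b s + c s² + d p + e p²` that separates a point of the plane from two others. -/
theorem exists_separating {s₀ p₀ s₁ p₁ s₂ p₂ : F} (h1 : ¬ (s₀ = s₁ ∧ p₀ = p₁))
    (h2 : ¬ (s₀ = s₂ ∧ p₀ = p₂)) :
    ∃ a b c d e : F, a + b * s₁ + c * s₁ ^ 2 + d * p₁ + e * p₁ ^ 2 = 0 ∧
      a + b * s₂ + c * s₂ ^ 2 + d * p₂ + e * p₂ ^ 2 = 0 ∧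
      a + b * s₀ + c * s₀ ^ 2 + d * p₀ + e * p₀ ^ 2 ≠ 0 := by
  -- The line through `(s₀, p₁)` and `(s₂, p₀)` misses `(s₀, p₀)`. It is needed when one point
  -- shares its `s` and the other its `p` with the point to be separated.
  have line : ∀ s₀ p₀ p₁ s₂ : F, p₀ ≠ p₁ → s₀ ≠ s₂ → ∃ a b d : F,
      a + b * s₀ + d * p₁ = 0 ∧ a + b * s₂ + d * p₀ = 0 ∧ a + b * s₀ + d * p₀ ≠ 0 := by
    intro s₀ p₀ p₁ s₂ hp hs
    refine ⟨-s₀ * (p₀ - p₁) + p₁ * (s₂ - s₀), p₀ - p₁, -(s₂ - s₀), by ring, by ring, ?_⟩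
    have := mul_ne_zero (sub_ne_zero.2 hp) (sub_ne_zero.2 hs)
    exact fun h => this (by linear_combination h)
  by_cases hs1 : s₀ = s₁
  · have hp1 : p₀ ≠ p₁ := fun h => h1 ⟨hs1, h⟩
    by_cases hp2 : p₀ = p₂
    · have hs2 : s₀ ≠ s₂ := fun h => h2 ⟨h, hp2⟩
      obtain ⟨a, b, d, e1, e2, e3⟩ := line s₀ p₀ p₁ s₂ hp1 hs2
      refine ⟨a, b, 0, d, 0, ?_, ?_, ?_⟩
      · rw [← hs1]; linear_combination e1
      · rw [← hp2]; linear_combination e2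
      · exact fun h => e3 (by linear_combination h)
    -- The coefficients of `(p - p₁)(p - p₂)`.
    · refine ⟨p₁ * p₂, 0, 0, -(p₁ + p₂), 1, by ring, by ring, fun h => ?_⟩
      exact mul_ne_zero (sub_ne_zero.2 hp1) (sub_ne_zero.2 hp2) (by linear_combination h)
  · by_cases hs2 : s₀ = s₂
    · have hp2 : p₀ ≠ p₂ := fun h => h2 ⟨hs2, h⟩
      by_cases hp1 : p₀ = p₁
      · obtain ⟨a, b, d, e1, e2, e3⟩ := line s₀ p₀ p₂ s₁ hp2 hs1
        refine ⟨a, b, 0, d, 0, ?_, ?_, ?_⟩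
        · rw [← hp1]; linear_combination e2
        · rw [← hs2]; linear_combination e1
        · exact fun h => e3 (by linear_combination h)
      · refine ⟨p₁ * p₂, 0, 0, -(p₁ + p₂), 1, by ring, by ring, fun h => ?_⟩
        exact mul_ne_zero (sub_ne_zero.2 hp1) (sub_ne_zero.2 hp2) (by linear_combination h)
    · refine ⟨s₁ * s₂, -(s₁ + s₂), 1, 0, 0, by ring, by ring, fun h => ?_⟩
      exact mul_ne_zero (sub_ne_zero.2 hs1) (sub_ne_zero.2 hs2) (by linear_combination h)

/-- If at most three coordinates were nonzero, a function in the span of `1, s, s², p, p²` vanishing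
at all but one of the corresponding points would isolate a single nonzero term of a sum that must be
zero. -/
theorem IsTraceNorm.four_le_hammingNorm [DecidableEq F]
    (h : IsTraceNorm q (evalPoints α β ht) s p)
    (hαβ : IsListing α β) (hq : Fintype.card F = q) {u : Fin (t + r) → F}
    (hu : u ∈ dualCode (evalCode (wFive F q) (evalPoints α β ht))) (hu0 : u ≠ 0) :
    4 ≤ hammingNorm u := by
  obtain ⟨h1, h2, h3, h4, h5⟩ := (h.mem_dualCode_wFive_iff u).1 hu
  obtain ⟨i₀, hi₀⟩ := Function.ne_iff.1 hu0
  rw [Pi.zero_apply] at hi₀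
  by_contra! hlt
  set S := Finset.univ.filter fun i => u i ≠ 0 with hS
  have hScard : S.card < 4 := hlt
  have hi₀S : i₀ ∈ S := by simp [hS, hi₀]
  have hT : (S.erase i₀).card ≤ 2 := by
    rw [Finset.card_erase_of_mem hi₀S]
    omega
  have hsep : ∃ a b c d e : F,
      (∀ i ∈ S.erase i₀, a + b * s i + c * s i ^ 2 + d * p i + e * p i ^ 2 = 0) ∧
      a + b * s i₀ + c * s i₀ ^ 2 + d * p i₀ + e * p i₀ ^ 2 ≠ 0 := by
    have two : ∀ j k, j ≠ i₀ → k ≠ i₀ → (∀ i ∈ S.erase i₀, i = j ∨ i = k) → ∃ a b c d e : F,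
        (∀ i ∈ S.erase i₀, a + b * s i + c * s i ^ 2 + d * p i + e * p i ^ 2 = 0) ∧
        a + b * s i₀ + c * s i₀ ^ 2 + d * p i₀ + e * p i₀ ^ 2 ≠ 0 := by
      intro j k hj hk hjk
      obtain ⟨a, b, c, d, e, e1, e2, e3⟩ := exists_separating
        (fun hc => hj (h.eq_of_eq hαβ hq hc.1 hc.2).symm : ¬ (s i₀ = s j ∧ p i₀ = p j))
        (fun hc => hk (h.eq_of_eq hαβ hq hc.1 hc.2).symm : ¬ (s i₀ = s k ∧ p i₀ = p k))
      refine ⟨a, b, c, d, e, fun i hi => ?_, e3⟩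
      rcases hjk i hi with rfl | rfl
      · exact e1
      · exact e2
    rcases Nat.lt_or_ge (S.erase i₀).card 1 with h0 | h0
    · have : S.erase i₀ = ∅ := Finset.card_eq_zero.1 (by omega)
      exact ⟨1, 0, 0, 0, 0, by simp [this], by simp⟩
    · rcases Nat.lt_or_ge (S.erase i₀).card 2 with h0' | h0'
      · obtain ⟨j, hj⟩ := Finset.card_eq_one.1 (by omega : (S.erase i₀).card = 1)
        have hj0 : j ≠ i₀ := Finset.ne_of_mem_erase (by rw [hj]; simp)
        exact two j j hj0 hj0 (by simp [hj])
      · obtain ⟨j, k, -, hjk⟩ := Finset.card_eq_two.1 (by omega : (S.erase i₀).card = 2)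
        have hj0 : j ≠ i₀ := Finset.ne_of_mem_erase (by rw [hjk]; simp)
        have hk0 : k ≠ i₀ := Finset.ne_of_mem_erase (by rw [hjk]; simp)
        exact two j k hj0 hk0 (by simp [hjk])
  obtain ⟨a, b, c, d, e, e1, e2⟩ := hsep
  have hsum : ∑ i, u i * (a + b * s i + c * s i ^ 2 + d * p i + e * p i ^ 2) = 0 := by
    calc _ = a * ∑ i, u i + b * ∑ i, u i * s i + c * ∑ i, u i * s i ^ 2 +
          d * ∑ i, u i * p i + e * ∑ i, u i * p i ^ 2 := by
          simp only [Finset.mul_sum, ← Finset.sum_add_distrib]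
          exact Finset.sum_congr rfl fun i _ => by ring
      _ = 0 := by rw [h1, h2, h3, h4, h5]; ring
  rw [Finset.sum_eq_single i₀] at hsum
  · exact mul_ne_zero hi₀ e2 hsum
  · intro i _ hi
    by_cases hui : u i = 0
    · rw [hui, zero_mul]
    · rw [e1 i (Finset.mem_erase.2 ⟨hi, by simp [hS, hui]⟩), mul_zero]
  · exact fun hc => absurd (Finset.mem_univ _) hc

/-- Four of the points `(s i, p i)` carry a relation between `1, s, s², p, p²` that the product
`s p` violates. -/
def HasQuadrupleRelation {ι : Type*} (s p : ι → F) : Prop :=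
  ∃ (i : Fin 4 → ι) (c : Fin 4 → F), ∑ k, c k = 0 ∧ ∑ k, c k * s (i k) = 0 ∧
    ∑ k, c k * s (i k) ^ 2 = 0 ∧ ∑ k, c k * p (i k) = 0 ∧ ∑ k, c k * p (i k) ^ 2 = 0 ∧
    ∑ k, c k * (s (i k) * p (i k)) ≠ 0

theorem IsTraceNorm.isLeast_diffWeights [DecidableEq F]
    (h : IsTraceNorm q (evalPoints α β ht) s p)
    (hαβ : IsListing α β) (hq : Fintype.card F = q) (hm : 4 ≤ m ∨ m = 3 ∧ 2 ≤ l)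
    (hrel : HasQuadrupleRelation s p) :
    IsLeast (diffWeights (dualCode (evalCode (wFive F q) (evalPoints α β ht)))
      (dualCode (evalCode (xlSpace F q m l) (evalPoints α β ht)))) 4 := by
  refine ⟨?_, ?_⟩
  · obtain ⟨i, c, h1, h2, h3, h4, h5, h6⟩ := hrel
    -- The four indices need not be distinct: coincidences only lower the weight, which the lower
    -- bound then excludes.
    set u : Fin (t + r) → F := ∑ k, Pi.single (i k) (c k) with hu
    have hdot : ∀ v : Fin (t + r) → F, ∑ j, u j * v j = ∑ k, c k * v (i k) := by
      intro v
      change u ⬝ᵥ v = _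
      rw [hu, sum_dotProduct]
      exact Finset.sum_congr rfl fun k _ => single_dotProduct _ _ _
    have hmem : u ∈ dualCode (evalCode (wFive F q) (evalPoints α β ht)) := by
      rw [h.mem_dualCode_wFive_iff]
      refine ⟨?_, ?_, ?_, ?_, ?_⟩
      · simpa [h1] using hdot 1
      · rw [hdot, h2]
      · rw [hdot (fun j => s j ^ 2), h3]
      · rw [hdot, h4]
      · rw [hdot (fun j => p j ^ 2), h5]
    have hnmem : u ∉ dualCode (evalCode (xlSpace F q m l) (evalPoints α β ht)) := by
      intro hc
      refine h6 ?_
      rw [← hdot (fun j => s j * p j)]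
      refine hc _ ⟨ePoly F q 1 2, ePoly_mem_xlSpace (by omega) (by omega), fun j => ?_⟩
      rw [ePoly_one_two, map_mul, h.trace, h.norm]
      simp only [map_mul, map_add, map_pow, aeval_X]
      ring
    have hle : hammingNorm u ≤ 4 := by
      have hsub : (Finset.univ.filter fun j => u j ≠ 0) ⊆ Finset.univ.image i := by
        intro j hj
        by_contra hji
        refine (Finset.mem_filter.1 hj).2 ?_
        rw [hu, Finset.sum_apply]
        refine Finset.sum_eq_zero fun k _ => Pi.single_eq_of_ne ?_ _
        rintro rfl
        exact hji (Finset.mem_image_of_mem i (Finset.mem_univ k))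
      exact (Finset.card_le_card hsub).trans (Finset.card_image_le.trans_eq (by simp))
    have hu0 : u ≠ 0 := fun h0 => hnmem (h0 ▸ zero_mem _)
    exact ⟨u, hmem, hnmem, le_antisymm hle (h.four_le_hammingNorm hαβ hq hmem hu0)⟩
  · rintro _ ⟨u, hu, hu', rfl⟩
    exact h.four_le_hammingNorm hαβ hq hu fun h0 => hu' (h0 ▸ zero_mem _)

-- The alternating signs annihilate every `g(s) + h(p)`, whereas `s p` sums to `(a - a')(b - b')`.
omit [Fintype F] in
theorem hasQuadrupleRelation_of_rectangle {ι : Type*} {s p : ι → F} {a a' b b' : F} (ha : a ≠ a')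
    (hb : b ≠ b') (h1 : ∃ i, s i = a ∧ p i = b) (h2 : ∃ i, s i = a ∧ p i = b')
    (h3 : ∃ i, s i = a' ∧ p i = b) (h4 : ∃ i, s i = a' ∧ p i = b') :
    HasQuadrupleRelation s p := by
  obtain ⟨i1, rfl, rfl⟩ := h1
  obtain ⟨i2, h2, rfl⟩ := h2
  obtain ⟨i3, rfl, h3⟩ := h3
  obtain ⟨i4, h4, h4'⟩ := h4
  refine ⟨![i1, i2, i3, i4], ![1, -1, -1, 1], ?_, ?_, ?_, ?_, ?_, ?_⟩ <;>
    simp only [Fin.sum_univ_four, Matrix.cons_val, h2, h3, h4, h4']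
  · ring
  · ring
  · ring
  · ring
  · ring
  · intro h
    exact mul_ne_zero (sub_ne_zero.2 ha) (sub_ne_zero.2 hb) (by linear_combination h)

end Coordinates

end AsymQuantum

namespace AsymQuantum

/-! ### Existence of the four points -/

section Configurations

variable {F K : Type*} [Field F] [Fintype F] [Field K] [Algebra F K] {q r t : ℕ}
  {α : Fin q → F} {β : Fin r → K} {ht : t ≤ q} {s p : Fin (t + r) → F}

theorem IsListing.exists_pow_ne (hαβ : IsListing α β) (hq : Fintype.card F = q)
    (hK : Module.finrank F K = 2) : ∃ x : K, x ^ q ≠ x := by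
  have h1 := hαβ.two_mul_add hq hK
  have h2 : 1 < q := hq ▸ Fintype.one_lt_card
  have h3 : 0 < r := by
    by_contra h0
    obtain rfl : r = 0 := by omega
    nlinarith
  exact ⟨β ⟨0, h3⟩, hαβ.beta_pow_ne _ _⟩

/-- With `θ^q = -θ`, the element `a + cθ` has trace `2a` and norm `a² + c² e`, where `e` is the norm
of `θ`. Replacing `a` by `-a` keeps the norm, so `a = ±1` with two values of `c` of different
squares gives a rectangle. -/
theorem IsTraceNorm.hasQuadrupleRelation_of_odd (h : IsTraceNorm q (evalPoints α β ht) s p)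
    (hαβ : IsListing α β) (hq : Fintype.card F = q) (hK : Module.finrank F K = 2)
    (h2 : (2 : F) ≠ 0) (hq5 : 5 ≤ q) : HasQuadrupleRelation s p := by
  classical
  obtain ⟨x, hx⟩ := hαβ.exists_pow_ne hq hK
  have h2K : (2 : K) ≠ 0 := by
    rw [← map_ofNat (algebraMap F K) 2]
    exact (_root_.map_ne_zero _).2 h2
  set θ := x - x ^ q with hθ
  have hθq : θ ^ q = -θ := by rw [hθ, sub_pow_card_field hq, pow_card_pow_card hq hK, neg_sub]
  have hθ0 : θ ≠ 0 := sub_ne_zero.2 hx.symm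
  obtain ⟨e, he⟩ := hαβ.exists_norm hq hK θ
  rw [hθq] at he
  have he0 : e ≠ 0 := by
    rintro rfl
    rw [map_zero] at he
    exact mul_ne_zero hθ0 (neg_ne_zero.2 hθ0) he.symm
  have point : ∀ a c : F, c ≠ 0 → ∃ i, s i = 2 * a ∧ p i = a ^ 2 + c ^ 2 * e := by
    intro a c hc
    have hpow : (algebraMap F K a + algebraMap F K c * θ) ^ q =
        algebraMap F K a - algebraMap F K c * θ := by
      rw [add_pow_card_field hq, mul_pow, algebraMap_pow_card hq, algebraMap_pow_card hq, hθq]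
      ring
    refine h.exists_index hαβ hq hK (x := algebraMap F K a + algebraMap F K c * θ) ?_ ?_ ?_
    · rw [hpow]
      intro hc'
      have h3 : 2 * (algebraMap F K c * θ) ≠ 0 :=
        mul_ne_zero h2K (mul_ne_zero ((_root_.map_ne_zero _).2 hc) hθ0)
      exact h3 (by linear_combination -hc')
    · rw [hpow, map_mul, map_ofNat]
      ring
    · rw [hpow, map_add, map_mul, map_pow, map_pow, he]
      ring
  -- Nonzero `c` keeps the point off `F`, and `c ≠ ±1` separates its norm from that of `c = 1`; this
  -- uses `q > 3`.
  obtain ⟨c, hc⟩ : ∃ c : F, c ∉ ({0, 1, -1} : Finset F) := by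
    by_contra! hall
    have h3 : (Finset.univ : Finset F).card ≤ ({0, 1, -1} : Finset F).card :=
      Finset.card_le_card fun c _ => hall c
    have h4 := h3.trans Finset.card_le_three
    rw [Finset.card_univ, hq] at h4
    omega
  simp only [Finset.mem_insert, Finset.mem_singleton, not_or] at hc
  have hc2 : (1 : F) ^ 2 + 1 ^ 2 * e ≠ 1 ^ 2 + c ^ 2 * e := by
    intro hce
    have h3 : e * ((c - 1) * (c + 1)) = 0 := by linear_combination -hce
    rcases mul_eq_zero.1 h3 with h4 | h4
    · exact he0 h4
    · rcases mul_eq_zero.1 h4 with h5 | h5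
      · exact hc.2.1 (sub_eq_zero.1 h5)
      · exact hc.2.2 (eq_neg_of_add_eq_zero_left h5)
  have ha : (2 : F) * 1 ≠ 2 * -1 := by
    intro ha
    exact mul_ne_zero h2 h2 (by linear_combination ha)
  refine hasQuadrupleRelation_of_rectangle ha hc2 (point 1 1 one_ne_zero) (point 1 c hc.1) ?_ ?_
  · simpa using point (-1) 1 one_ne_zero
  · simpa using point (-1) c hc.1

/-- In characteristic two, with `n` the norm of an element of trace one, the points of nonzero
trace are the `(v, u² + u v + v² n)`. -/
theorem IsTraceNorm.exists_index_of_char_two [CharP F 2]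
    (h : IsTraceNorm q (evalPoints α β ht) s p)
    (hαβ : IsListing α β) (hq : Fintype.card F = q) (hK : Module.finrank F K = 2) :
    ∃ n : F, (∀ u, n ≠ u ^ 2 + u) ∧
      ∀ u v : F, v ≠ 0 → ∃ i, s i = v ∧ p i = u ^ 2 + u * v + v ^ 2 * n := by
  have : CharP K 2 := charP_of_injective_algebraMap (algebraMap F K).injective 2
  have h2 : (2 : K) = 0 := CharTwo.two_eq_zero
  obtain ⟨x, hx⟩ := hαβ.exists_pow_ne hq hK
  obtain ⟨τ, hτ⟩ := hαβ.exists_trace hq hK x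
  have hτ0 : algebraMap F K τ ≠ 0 := by
    rw [hτ]
    intro h0
    exact hx (CharTwo.add_eq_zero.1 h0).symm
  -- Division by the trace makes the trace of `ω` equal to 1, so `ω^q = ω + 1` and `ω² + ω = n`. A
  -- solution `u` in `F` of `u² + u = n` would make `ω` rational.
  set ω := x / algebraMap F K τ with hω
  have hωq : ω ^ q = ω + 1 := by
    rw [hω, div_pow, algebraMap_pow_card hq, div_add_one hτ0]
    congr 1
    rw [hτ]
    linear_combination (-x) * h2
  obtain ⟨n, hn⟩ := hαβ.exists_norm hq hK ω
  rw [hωq] at hn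
  have point : ∀ u v : F, (algebraMap F K u + algebraMap F K v * ω) ^ q =
      algebraMap F K u + algebraMap F K v * ω + algebraMap F K v := fun u v => by
    rw [add_pow_card_field hq, mul_pow, algebraMap_pow_card hq, algebraMap_pow_card hq, hωq]
    ring
  refine ⟨n, fun u hu => ?_, fun u v hv => ?_⟩
  · have h3 : (ω - algebraMap F K u) * (ω + algebraMap F K u + 1) = 0 := by
      have := congrArg (algebraMap F K) hu
      rw [map_add, map_pow, hn] at this
      linear_combination this
    have h4 : ∃ a, algebraMap F K a = ω := by
      rcases mul_eq_zero.1 h3 with h5 | h5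
      · exact ⟨u, (sub_eq_zero.1 h5).symm⟩
      · refine ⟨-u - 1, ?_⟩
        rw [map_sub, map_neg, map_one]
        linear_combination -h5
    obtain ⟨a, ha⟩ := h4
    have h5 := algebraMap_pow_card (K := K) hq a
    rw [ha, hωq] at h5
    simp at h5
  · refine h.exists_index hαβ hq hK (x := algebraMap F K u + algebraMap F K v * ω) ?_ ?_ ?_
    · rw [point]
      simpa using hv
    · rw [point]
      linear_combination (-(algebraMap F K u + algebraMap F K v * ω)) * h2
    · rw [point]
      simp only [map_add, map_mul, map_pow, hn]
      linear_combination (-(algebraMap F K u * algebraMap F K v * ω)) * h2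

omit [Fintype F] in
theorem card_le_two_mul_card_image_quadratic [DecidableEq F] (S : Finset F) (v n : F) :
    S.card ≤ 2 * (S.image fun u => u ^ 2 + u * v + n).card := by
  refine Finset.card_le_mul_card_image S 2 fun b hb => ?_
  obtain ⟨u₀, -, rfl⟩ := Finset.mem_image.1 hb
  refine (Finset.card_le_card (t := {u₀, -u₀ - v}) fun u hu => ?_).trans Finset.card_le_two
  have hu' := (Finset.mem_filter.1 hu).2
  have h3 : (u - u₀) * (u - (-u₀ - v)) = 0 := by linear_combination hu'
  rw [Finset.mem_insert, Finset.mem_singleton]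
  exact (mul_eq_zero.1 h3).imp sub_eq_zero.1 sub_eq_zero.1

theorem card_add_card_add_card_le {γ : Type*} [Fintype γ] [DecidableEq γ] (A B C : Finset γ) :
    A.card + B.card + C.card ≤
      Fintype.card γ + (A ∩ B).card + (A ∩ C).card + (B ∩ C).card := by
  have h1 := Finset.card_union_add_card_inter A B
  have h2 := Finset.card_union_add_card_inter (A ∪ B) C
  have h3 := Finset.card_le_univ ((A ∪ B) ∪ C)
  have h4 : ((A ∪ B) ∩ C).card ≤ (A ∩ C).card + (B ∩ C).card := by
    rw [Finset.union_inter_distrib_right]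
    exact Finset.card_union_le _ _
  omega

/-- For each nonzero trace `v` the available norms fill at least half of `F`, the quadratic map
being at most two-to-one. Three such sets have pairwise intersections of total size at least `q/2 >
3`, so two of them share two norms and give a rectangle. -/
theorem IsTraceNorm.hasQuadrupleRelation_of_even [CharP F 2]
    (h : IsTraceNorm q (evalPoints α β ht) s p)
    (hαβ : IsListing α β) (hq : Fintype.card F = q) (hK : Module.finrank F K = 2)
    (hq7 : 7 ≤ q) : HasQuadrupleRelation s p := by
  classical
  obtain ⟨n, -, hpt⟩ := h.exists_index_of_char_two hαβ hq hK
  let N : F → Finset F := fun v => Finset.univ.image fun u => u ^ 2 + u * v + v ^ 2 * n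
  have hN : ∀ v, q ≤ 2 * (N v).card := fun v => by
    have := card_le_two_mul_card_image_quadratic Finset.univ v (v ^ 2 * n)
    rwa [Finset.card_univ, hq] at this
  have hmem : ∀ v b, v ≠ 0 → b ∈ N v → ∃ i, s i = v ∧ p i = b := by
    intro v b hv hb
    obtain ⟨u, -, rfl⟩ := Finset.mem_image.1 hb
    exact hpt u v hv
  have rect : ∀ v w, v ≠ 0 → w ≠ 0 → v ≠ w → 1 < (N v ∩ N w).card →
      HasQuadrupleRelation s p := by
    intro v w hv hw hvw hcard
    obtain ⟨b, hb, b', hb', hbb⟩ := Finset.one_lt_card.1 hcard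
    rw [Finset.mem_inter] at hb hb'
    exact hasQuadrupleRelation_of_rectangle hvw hbb (hmem v b hv hb.1) (hmem v b' hv hb'.1)
      (hmem w b hw hb.2) (hmem w b' hw hb'.2)
  have hthree : 2 < (Finset.univ.erase (0 : F)).card := by
    rw [Finset.card_erase_of_mem (Finset.mem_univ _), Finset.card_univ, hq]
    omega
  obtain ⟨v₁, v₂, v₃, h1, h2, h3, h12, h13, h23⟩ := Finset.two_lt_card_iff.1 hthree
  have h1 := Finset.ne_of_mem_erase h1
  have h2 := Finset.ne_of_mem_erase h2
  have h3 := Finset.ne_of_mem_erase h3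
  have hcount := card_add_card_add_card_le (N v₁) (N v₂) (N v₃)
  have hN1 := hN v₁
  have hN2 := hN v₂
  have hN3 := hN v₃
  rw [hq] at hcount
  by_cases c12 : 1 < (N v₁ ∩ N v₂).card
  · exact rect _ _ h1 h2 h12 c12
  by_cases c13 : 1 < (N v₁ ∩ N v₃).card
  · exact rect _ _ h1 h3 h13 c13
  · exact rect _ _ h2 h3 h23 (by omega)

theorem IsTraceNorm.hasQuadrupleRelation_of_five_le (h : IsTraceNorm q (evalPoints α β ht) s p)
    (hαβ : IsListing α β) (hq : Fintype.card F = q) (hK : Module.finrank F K = 2)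
    (hq5 : 5 ≤ q) : HasQuadrupleRelation s p := by
  by_cases h2 : (2 : F) = 0
  · have : CharP F 2 := CharTwo.of_one_ne_zero_of_two_eq_zero one_ne_zero h2
    obtain ⟨k, -, hk⟩ := FiniteField.card F 2
    rw [hq] at hk
    have h3 : 3 ≤ (k : ℕ) := by
      by_contra! hlt
      have := Nat.pow_le_pow_right two_pos (show (k : ℕ) ≤ 2 by omega)
      omega
    have h4 := Nat.pow_le_pow_right two_pos h3
    exact h.hasQuadrupleRelation_of_even hαβ hq hK (by omega)
  · exact h.hasQuadrupleRelation_of_odd hαβ hq hK h2 hq5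

/-- Over `F₄` the norm sets for traces `1, n, n + 1` are `{n, n+1}`, `{1, n}`, `{1, n+1}`, which
share only one element pairwise, so nonrational points give no rectangle. Instead one point of each
trace is taken with all coefficients 1. The sums of `1`, `s` and `s²` then vanish, and the sum of
`p²` is the square of the sum of `p`. The trace-zero point is the rational one, whence `t ≥ 1`. -/
theorem IsTraceNorm.hasQuadrupleRelation_of_four (h : IsTraceNorm q (evalPoints α β ht) s p)
    (hαβ : IsListing α β) (hq : Fintype.card F = q) (hK : Module.finrank F K = 2)
    (hq4 : q = 4) (ht1 : 1 ≤ t) : HasQuadrupleRelation s p := by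
  classical
  have : CharP F 2 := by
    have h2 : ringChar F = 2 := FiniteField.even_card_iff_char_two.2 (by rw [hq, hq4])
    exact h2 ▸ ringChar.charP F
  have h2 : (2 : F) = 0 := CharTwo.two_eq_zero
  have hpow : ∀ a : F, a ^ 4 = a := fun a => by
    have := FiniteField.pow_card a
    rwa [hq, hq4] at this
  obtain ⟨n, hn, hpt⟩ := h.exists_index_of_char_two hαβ hq hK
  have hn0 : n ≠ 0 := fun h0 => hn 0 (by rw [h0]; ring)
  have hn1 : n ≠ 1 := by
    rintro rfl
    obtain ⟨u, hu⟩ : ∃ u : F, u ∉ ({0, 1} : Finset F) := by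
      by_contra! hall
      have h3 : (Finset.univ : Finset F).card ≤ ({0, 1} : Finset F).card :=
        Finset.card_le_card fun c _ => hall c
      have h4 := h3.trans Finset.card_le_two
      rw [Finset.card_univ, hq] at h4
      omega
    simp only [Finset.mem_insert, Finset.mem_singleton, not_or] at hu
    have h3 : u * ((u - 1) * (u ^ 2 + u + 1)) = 0 := by linear_combination hpow u
    have h4 := ((mul_eq_zero.1 h3).resolve_left hu.1)
    have h5 := (mul_eq_zero.1 h4).resolve_left (sub_ne_zero.2 hu.2)
    exact hn u (by linear_combination h2 - h5)
  have hnn : n ^ 2 = n + 1 := by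
    have h3 : n * ((n - 1) * (n ^ 2 + n + 1)) = 0 := by linear_combination hpow n
    have h4 := ((mul_eq_zero.1 h3).resolve_left hn0)
    have h5 := (mul_eq_zero.1 h4).resolve_left (sub_ne_zero.2 hn1)
    linear_combination h5 - (n + 1) * h2
  have hn1' : n + 1 ≠ 0 := fun h0 => hn1 (by linear_combination h0 - h2)
  obtain ⟨A, i₀, hs0, hp0⟩ : ∃ A, ∃ i, s i = 0 ∧ p i = A := by
    refine ⟨_, Fin.castAdd r ⟨0, ht1⟩, ?_, rfl⟩
    have h3 := h.trace (Fin.castAdd r ⟨0, ht1⟩)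
    rw [evalPoints_castAdd, algebraMap_pow_card hq, ← map_add, CharTwo.add_self_eq_zero] at h3
    exact (algebraMap F K).injective h3
  have pt : ∀ u v b : F, v ≠ 0 → b = u ^ 2 + u * v + v ^ 2 * n → ∃ i, s i = v ∧ p i = b :=
    fun u v b hv hb => hb ▸ hpt u v hv
  have p1a := pt 0 1 n one_ne_zero (by ring)
  have pna := pt 0 n 1 hn0 (by grind)
  have pnb := pt 1 n n hn0 (by grind)
  have pma := pt 0 (n + 1) (n + 1) hn1' (by grind)
  have pmb := pt 1 (n + 1) 1 hn1' (by grind)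
  have quad : ∀ b c d : F, (∃ i, s i = 1 ∧ p i = b) → (∃ i, s i = n ∧ p i = c) →
      (∃ i, s i = n + 1 ∧ p i = d) → A + b + c + d = 0 → b + n * c + (n + 1) * d ≠ 0 →
      HasQuadrupleRelation s p := by
    rintro b c d ⟨i1, hs1, hp1⟩ ⟨i2, hs2, hp2⟩ ⟨i3, hs3, hp3⟩ hsum hne
    refine ⟨![i₀, i1, i2, i3], 1, ?_, ?_, ?_, ?_, ?_, ?_⟩ <;>
      simp only [Fin.sum_univ_four, Matrix.cons_val, Pi.one_apply, hs0, hs1, hs2, hs3, hp0, hp1,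
        hp2, hp3]
    · linear_combination 2 * h2
    · linear_combination (n + 1) * h2
    · linear_combination (n ^ 2 + n + 1) * h2
    · linear_combination hsum
    · grind
    · exact fun h0 => hne (by linear_combination h0)
  -- This is `A⁴ = A` factored. For each of the four values of the norm `A`, a choice of norms at
  -- the other points makes the total vanish.
  have hA : A * ((A + 1) * ((A + n) * (A + n + 1))) = 0 := by
    have := hpow A
    grind
  rcases mul_eq_zero.1 hA with hA | hA
  · exact quad _ _ _ p1a pna pma (by grind) (by grind)
  rcases mul_eq_zero.1 hA with hA | hA
  · exact quad _ _ _ p1a pnb pmb (by grind) (by grind)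
  rcases mul_eq_zero.1 hA with hA | hA
  · exact quad _ _ _ p1a pna pmb (by grind) (by grind)
  · exact quad _ _ _ p1a pnb pma (by grind) (by grind)

end Configurations

/-! ### Assembly of the theorem -/

section Main

variable {F K : Type*} [Field F] [Fintype F] [DecidableEq F] [Field K] [Algebra F K]
  {q r t m l : ℕ} {α : Fin q → F} {β : Fin r → K} {ht : t ≤ q} {s p : Fin (t + r) → F}

theorem IsTraceNorm.isAQC_cssSpace (h : IsTraceNorm q (evalPoints α β ht) s p)
    (hαβ : IsListing α β) (hq : Fintype.card F = q) (hK : Module.finrank F K = 2)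
    (hm : 4 ≤ m ∨ m = 3 ∧ 2 ≤ l) (hmq : m ≤ q - 1) (hl : l ≤ m - 1)
    (hrel : HasQuadrupleRelation s p) :
    evalCode (wFive F q) (evalPoints α β ht) < evalCode (xlSpace F q m l) (evalPoints α β ht) ∧
      ∃ (Q : Submodule ℂ (QuditSpace F (t + r))) (dz : ℕ),
        designDist q t m l ≤ (dz : ℚ) ∧ IsAQC Q (m * (m - 1) / 2 + l - 4) dz 4 ∧
        ¬ Detects Q 1 5 ∧
        IsCSS Q (dualCode (evalCode (wFive F q) (evalPoints α β ht)))
          (evalCode (xlSpace F q m l) (evalPoints α β ht)) dz 4 := by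
  set E := evalCode (wFive F q) (evalPoints α β ht) with hE
  set C := evalCode (xlSpace F q m l) (evalPoints α β ht) with hC
  have hWV := wFive_le_xlSpace (F := F) (q := q) hm
  have hle : E ≤ C := evalCode_mono hWV _
  have hval : ∀ f ∈ xlSpace F q m l, ∀ i, ∃ c : F,
      algebraMap F K c = aeval (evalPoints α β ht i) f := fun f hf i =>
    hαβ.exists_algebraMap hq hK (by
      rw [← aeval_pow_card hq, aeval_pow_card_of_mem_xlSpace hq hK hf])
  have hinj : ∀ f ∈ xlSpace F q m l, (∀ i, aeval (evalPoints α β ht i) f = 0) → f = 0 :=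
    fun f hf => eq_zero_of_forall_aeval_evalPoints_eq_zero hαβ hq hK (by omega) hmq hl hf
  have hEdim : Module.finrank F E = 5 := by
    rw [hE, finrank_evalCode (fun f hf => hval f (hWV hf)) (fun f hf => hinj f (hWV hf)),
      finrank_wFive (by omega)]
  have hCdim : Module.finrank F C = m * (m - 1) / 2 + l + 1 := by
    rw [hC, finrank_evalCode hval hinj, finrank_xlSpace (by omega) (by omega) hl]
  -- Dimension at least 6 against 5 makes the inclusion strict, so `C ∖ E` has a word of least
  -- weight; that weight is `dz`.
  have hbig : 6 ≤ m * (m - 1) / 2 + l + 1 := by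
    rcases hm with hm | ⟨rfl, hl2⟩
    · have : 4 * 3 ≤ m * (m - 1) := Nat.mul_le_mul hm (by omega)
      omega
    · omega
  have hlt : E < C := lt_of_le_of_ne hle fun hEC => by
    rw [hEC] at hEdim
    omega
  have hdd : dualCode (dualCode E) = E := dualCode_dualCode E
  have hnest : dualCode (dualCode E) ≤ C := hdd.trans_le hle
  have hx : IsLeast (diffWeights (dualCode E) (dualCode C)) 4 :=
    h.isLeast_diffWeights hαβ hq hm hrel
  have hne : (diffWeights C (dualCode (dualCode E))).Nonempty := by
    obtain ⟨u, hu, hu'⟩ := SetLike.exists_of_lt hlt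
    exact ⟨_, u, hu, by rwa [hdd], rfl⟩
  obtain ⟨dz, hz⟩ : ∃ dz, IsLeast (diffWeights C (dualCode (dualCode E))) dz :=
    ⟨_, Nat.sInf_mem hne, fun _ hw => Nat.sInf_le hw⟩
  refine ⟨hlt, cssSpace (dualCode E) C, dz, ?_, ?_, not_detects_cssSpace hnest hx.1,
    hnest, rfl, hz, hx⟩
  · obtain ⟨u, hu, hu', rfl⟩ := hz.1
    exact designDist_le_hammingNorm hαβ hq hK (by omega) (by omega) hl hu
      fun h0 => hu' (h0 ▸ zero_mem _)
  · refine AsymQuantum.isAQC_cssSpace hnest ?_ hz hx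
    rw [hdd, hEdim, hCdim]
    omega

end Main

end AsymQuantum

theorem mainTheorem2 {F K : Type*} [Field F] [Fintype F] [DecidableEq F] [Field K] [Algebra F K]
    (q : ℕ) (hq : Fintype.card F = q) (hK : Module.finrank F K = 2)
    (α : Fin q → F) (β : Fin ((q ^ 2 - q) / 2) → K) (hαβ : AsymQuantum.IsListing α β)
    (t : ℕ) (ht : t ≤ q) :
    (5 ≤ q → ∀ m l : ℕ, 4 ≤ m → m ≤ q - 1 → l ≤ m - 1 →
      AsymQuantum.evalCode (AsymQuantum.wFive F q) (AsymQuantum.evalPoints α β ht) <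
          AsymQuantum.evalCode (AsymQuantum.xlSpace F q m l) (AsymQuantum.evalPoints α β ht) ∧
        ∃ (Q : Submodule ℂ (AsymQuantum.QuditSpace F (t + (q ^ 2 - q) / 2))) (dz : ℕ),
          AsymQuantum.designDist q t m l ≤ (dz : ℚ) ∧
          AsymQuantum.IsAQC Q (m * (m - 1) / 2 + l - 4) dz 4 ∧
          ¬ AsymQuantum.Detects Q 1 5 ∧
          AsymQuantum.IsCSS Q
            (AsymQuantum.dualCode
              (AsymQuantum.evalCode (AsymQuantum.wFive F q) (AsymQuantum.evalPoints α β ht)))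
            (AsymQuantum.evalCode (AsymQuantum.xlSpace F q m l) (AsymQuantum.evalPoints α β ht))
            dz 4) ∧
    (q = 4 → 1 ≤ t →
      AsymQuantum.evalCode (AsymQuantum.wFive F q) (AsymQuantum.evalPoints α β ht) <
          AsymQuantum.evalCode (AsymQuantum.xlSpace F q 3 2) (AsymQuantum.evalPoints α β ht) ∧
        ∃ (Q : Submodule ℂ (AsymQuantum.QuditSpace F (t + (q ^ 2 - q) / 2))) (dz : ℕ),
          AsymQuantum.designDist q t 3 2 ≤ (dz : ℚ) ∧
          AsymQuantum.IsAQC Q 1 dz 4 ∧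
          ¬ AsymQuantum.Detects Q 1 5 ∧
          AsymQuantum.IsCSS Q
            (AsymQuantum.dualCode
              (AsymQuantum.evalCode (AsymQuantum.wFive F q) (AsymQuantum.evalPoints α β ht)))
            (AsymQuantum.evalCode (AsymQuantum.xlSpace F q 3 2) (AsymQuantum.evalPoints α β ht))
            dz 4) := by
  obtain ⟨s, p, h⟩ := hαβ.exists_isTraceNorm hq hK ht
  refine ⟨fun hq5 m l hm hmq hl => ?_, fun hq4 ht1 => ?_⟩
  · exact h.isAQC_cssSpace hαβ hq hK (Or.inl hm) hmq hl
      (h.hasQuadrupleRelation_of_five_le hαβ hq hK hq5)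
  · exact h.isAQC_cssSpace (m := 3) (l := 2) hαβ hq hK (Or.inr ⟨rfl, le_rfl⟩) (by omega) (by omega)
      (h.hasQuadrupleRelation_of_four hαβ hq hK hq4 ht1)
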